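/- Let $N=\{1,\dots,n\}$ and let $3^N$ be the set of pairs $(X,Y)$ of disjoint subsets of $N$. Let $f:3^N\to\mathbb R$ with $f(\emptyset,\emptyset)=0$ be bisubmodular, i.e. $f(X_1,Y_1)+f(X_2,Y_2)\ge f\big((X_1\cup X_2)\setminus(Y_1\cup Y_2),(Y_1\cup Y_2)\setminus(X_1\cup X_2)\big)+f(X_1\cap X_2,Y_1\cap Y_2)$ for all signed sets. Put $x(X,Y)=\sum_{i\in X}x(i)-\sum_{i\in Y}x(i)$ and $\mathrm P_*(f)=\{x\in\mathbb R^N : x(X,Y)\le f(X,Y)\ \forall (X,Y)\in 3^N\}$. The greedy optimum $x^*$ is given by $x^*(i)=f(\{i,\dots,n\},\emptyset)-f(\{i+1,\dots,n\},\emptyset)$ for $i\in N$. Arcs of bidirected graphs on $N$ are identified with their boundaries $i-j$ ($i\ne j$), $i+j$, $-i-j$ in $\mathbb Z^N$; $\pm 2i$ are selfloops. The transitive closure of such a graph is obtained by repeatedly adding (a) $a+a'$, if $a\neq -a'$ are arcs, not both selfloops, oppositely incident to a common vertex, and (b) $(a+a')/2$, if $a,a'$ are selfloops at different vertices. For a vertex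 (extreme point) $x$ of $\mathrm P_*(f)$ let $\mathcal F(x)$ be the family of all $(X,Y)\in3^N$ with $x(X,Y)=f(X,Y)$. Let $\mathrm{sat}^{(\pm)}(x)$ be the set of $i\in N$ such that $x\pm\alpha\chi_i\notin \mathrm P_*(f)$ for all $\alpha>0$. For $i\in\mathrm{sat}^{(+)}(x)$ (resp. $i\in\mathrm{sat}^{(-)}(x)$) let $\mathrm{dep}(x,+i)$ (resp. $\mathrm{dep}(x,-i)$) be the componentwise intersection of all $(X,Y)\in\mathcal F(x)$ with $i\in X$ (resp. $i\in Y$); its components are written $\mathrm{dep}(x,\pm i)^+,\mathrm{dep}(x,\pm i)^-$. The bidirected graph $G(x)$ has the selfloops $2i$ ($i\notin\mathrm{sat}^{(+)}(x)$) and $-2i$ ($i\notin\mathrm{sat}^{(-)}(x)$), and, for $i\ne j$, the arc $i-j$ iff $j\in\mathrm{dep}(x,+i)^+$ or $i\in\mathrm{dep}(x,-j)^-$, the arc $i+j$ iff $j\in\mathrm{dep}(x,+i)^-$ or $i\in\mathrm{dep}(x,+j)^-$, and the arc $-i-j$ iff $j\in\mathrm{dep}(x,-i)^+$ or $i\in\mathrm{dep}(x,-j)^+$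 (a condition on a dep set counts only where that set is defined). The Hasse diagram $\mathcal H(x)$ is the minimal bidirected graph with the same transitive closure as $G(x)$. Proposition. For every vertex $x$ of $\mathrm P_*(f)$: $\mathcal H(x)$ has no arc of type $i+j$ ($i\le j$) and no arc of type $j-i$ ($i<j$) if and only if $x=x^*$. Consequently the local search function $g$ is well defined on all vertices $x\ne x^*$. Namely, let $j^*$ be the largest $j$ such that $\mathcal H(x)$ has an arc $j+i$ with $i\le j$ or $j-i$ with $i<j$. If there is an arc $j^*+i$ with $i\le j^*$, let $i^*$ be the largest such $i$ and $a^*=j^*+i^*$; otherwise let $i^*$ be the largest $i<j^*$ such that $j^*-i$ is an arc, and $a^*=j^*-i^*$. Let $c$ be the maximum of all $\alpha\ge 0$ with $x+\alpha a^*\in \mathrm P_*(f)$. Then for every vertex $x\neq x^*$ all these maxima exist, so that $g(x)=x+c\,a^*$ is uniquely determined, and $g(x)$ is a vertex of $\mathrm P_*(f)$ adjacent to $x$ (i.e. $g(x)\ne x$ and the segment $[x,g(x)]$ is a face of $\mathrm P_*(f)$). -/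

import Mathlib

/-- A signed subset of `N = Fin n`: an ordered pair of disjoint subsets. -/
@[ext]
structure SignedSet (n : ℕ) where
  pos : Finset (Fin n)
  neg : Finset (Fin n)
  disj : Disjoint pos neg

namespace SignedSet

variable {n : ℕ}

/-- The signed set `(∅, ∅)`. -/
def empty (n : ℕ) : SignedSet n := ⟨∅, ∅, Finset.disjoint_empty_right _⟩

/-- The signed set `(X, ∅)`. -/
def ofPos (X : Finset (Fin n)) : SignedSet n := ⟨X, ∅, Finset.disjoint_empty_right _⟩

/-- The reduced union `⊔` on signed sets. -/
def reducedUnion (S T : SignedSet n) : SignedSet n where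
  pos := (S.pos ∪ T.pos) \ (S.neg ∪ T.neg)
  neg := (S.neg ∪ T.neg) \ (S.pos ∪ T.pos)
  disj := Finset.disjoint_left.2 fun _ h₁ h₂ =>
    (Finset.mem_sdiff.1 h₁).2 (Finset.mem_sdiff.1 h₂).1

/-- The intersection `⊓` on signed sets. -/
def inter (S T : SignedSet n) : SignedSet n where
  pos := S.pos ∩ T.pos
  neg := S.neg ∩ T.neg
  disj := Finset.disjoint_of_subset_left Finset.inter_subset_left
    (Finset.disjoint_of_subset_right Finset.inter_subset_left S.disj)

/-- `x(X, Y) = x(X) - x(Y)`. -/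
def eval (x : Fin n → ℝ) (S : SignedSet n) : ℝ := ∑ i ∈ S.pos, x i - ∑ i ∈ S.neg, x i

end SignedSet

section Bisubmodular

variable {n : ℕ}

/-- Bisubmodularity of a biset function. -/
def IsBisubmodular (f : SignedSet n → ℝ) : Prop :=
  ∀ S T : SignedSet n, f (S.reducedUnion T) + f (S.inter T) ≤ f S + f T

/-- The bisubmodular polyhedron `P_*(f)`. -/
def bisubPolyhedron (f : SignedSet n → ℝ) : Set (Fin n → ℝ) :=
  {x | ∀ S : SignedSet n, S.eval x ≤ f S}

/-- The family `F(x)` of signed sets that are tight at `x`. -/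
def tightFamily (f : SignedSet n → ℝ) (x : Fin n → ℝ) : Set (SignedSet n) :=
  {S | S.eval x = f S}

/-- `sat⁽⁺⁾(x)`: the elements at which `x` is positively saturated. -/
def satPlus (f : SignedSet n → ℝ) (x : Fin n → ℝ) : Set (Fin n) :=
  {i | ∀ α : ℝ, 0 < α → x + α • Pi.single i (1 : ℝ) ∉ bisubPolyhedron f}

/-- `sat⁽⁻⁾(x)`: the elements at which `x` is negatively saturated. -/
def satMinus (f : SignedSet n → ℝ) (x : Fin n → ℝ) : Set (Fin n) :=
  {i | ∀ α : ℝ, 0 < α → x - α • Pi.single i (1 : ℝ) ∉ bisubPolyhedron f}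

/-- `dep(x, +i) = ⊓ {(X, Y) ∈ F(x) | i ∈ X}` as the pair `(dep(x, +i)⁺, dep(x, +i)⁻)`;
meaningful for `i ∈ satPlus f x` only, and used only there. -/
def depPlus (f : SignedSet n → ℝ) (x : Fin n → ℝ) (i : Fin n) : Set (Fin n) × Set (Fin n) :=
  ({k | ∀ S ∈ tightFamily f x, i ∈ S.pos → k ∈ S.pos},
   {k | ∀ S ∈ tightFamily f x, i ∈ S.pos → k ∈ S.neg})

/-- `dep(x, -i) = ⊓ {(X, Y) ∈ F(x) | i ∈ Y}` as the pair `(dep(x, -i)⁺, dep(x, -i)⁻)`;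
meaningful for `i ∈ satMinus f x` only, and used only there. -/
def depMinus (f : SignedSet n → ℝ) (x : Fin n → ℝ) (i : Fin n) : Set (Fin n) × Set (Fin n) :=
  ({k | ∀ S ∈ tightFamily f x, i ∈ S.neg → k ∈ S.pos},
   {k | ∀ S ∈ tightFamily f x, i ∈ S.neg → k ∈ S.neg})

/-- The greedy vector `x^*`: `x^*(i) = f({i, …, n}, ∅) - f({i+1, …, n}, ∅)`
(for the last index the subtracted term is `f(∅, ∅)`). -/
def greedyVertex (f : SignedSet n → ℝ) : Fin n → ℝ := fun i =>
  f (SignedSet.ofPos (Finset.Ici i)) - f (SignedSet.ofPos (Finset.Ioi i))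

end Bisubmodular

section Bidirected

variable {n : ℕ}

/-- The basis vector `i` of the free module `ℤ^N`. -/
def unitVec (i : Fin n) : Fin n → ℤ := Pi.single i 1

/-- The boundaries that an arc may have: `i - j` with `i ≠ j`, `i + j`, or `-i - j`
(in the last two types `i = j` is allowed and gives a selfloop). -/
def IsArcBoundary (a : Fin n → ℤ) : Prop :=
  ∃ i j : Fin n, (i ≠ j ∧ a = unitVec i - unitVec j) ∨ a = unitVec i + unitVec j ∨
    a = -unitVec i - unitVec j

/-- A bidirected graph on `Fin n`. An arc is identified with its boundary, and graphs are
ordered by inclusion of their arc sets. -/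
abbrev BidirectedGraph (n : ℕ) : Type :=
  {A : Set (Fin n → ℤ) // ∀ a ∈ A, IsArcBoundary a}

/-- `a` is a selfloop at `i`. -/
def IsSelfloopAt (a : Fin n → ℤ) (i : Fin n) : Prop :=
  a = (2 : ℤ) • unitVec i ∨ a = -((2 : ℤ) • unitVec i)

/-- The arcs generated from `A` by the two transitivity rules of signed posets.
In `trans` the sum is always an arc boundary unless it is `0` (the arcs are opposite);
`0` would be the prohibited selfloop `i - i`. -/
inductive TransGen (A : Set (Fin n → ℤ)) : (Fin n → ℤ) → Prop
  | base {a : Fin n → ℤ} : a ∈ A → TransGen A a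
  | trans {a a' : Fin n → ℤ} (v : Fin n) : TransGen A a → TransGen A a' →
      ¬ ((∃ i, IsSelfloopAt a i) ∧ ∃ i, IsSelfloopAt a' i) →
      a v * a' v < 0 → IsArcBoundary (a + a') → TransGen A (a + a')
  | loops {a a' b : Fin n → ℤ} (i j : Fin n) : TransGen A a → TransGen A a' →
      i ≠ j → IsSelfloopAt a i → IsSelfloopAt a' j →
      IsArcBoundary b → (2 : ℤ) • b = a + a' → TransGen A b

/-- The transitive closure of a bidirected graph. -/
def BidirectedGraph.transClosure (G : BidirectedGraph n) : BidirectedGraph n :=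
  ⟨{a | TransGen G.1 a}, by
    intro a ha
    cases ha with
    | base h => exact G.2 _ h
    | trans _ _ _ _ _ h => exact h
    | loops _ _ _ _ _ _ _ h _ => exact h⟩

/-- `H` is a Hasse diagram of `G`: a bidirected graph that is minimal among those that have the
same transitive closure as `G`. (For signed posets it is known to be unique.) -/
def IsHasseDiagram (H G : BidirectedGraph n) : Prop :=
  Minimal (fun K : BidirectedGraph n => K.transClosure = G.transClosure) H

lemma finite_arcBoundary : {a : Fin n → ℤ | IsArcBoundary a}.Finite := by
  refine ((Set.finite_range fun p : Fin n × Fin n => unitVec p.1 - unitVec p.2).union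
    ((Set.finite_range fun p : Fin n × Fin n => unitVec p.1 + unitVec p.2).union
    (Set.finite_range fun p : Fin n × Fin n => -unitVec p.1 - unitVec p.2))).subset ?_
  rintro a ⟨i, j, ⟨_, h⟩ | h | h⟩
  · exact Or.inl ⟨(i, j), h.symm⟩
  · exact Or.inr (Or.inl ⟨(i, j), h.symm⟩)
  · exact Or.inr (Or.inr ⟨(i, j), h.symm⟩)

/-- Every bidirected graph has a Hasse diagram. -/
lemma exists_isHasseDiagram (G : BidirectedGraph n) : ∃ H, IsHasseDiagram H G := by
  have : Finite (BidirectedGraph n) :=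
    Set.Finite.finite_subsets (finite_arcBoundary (n := n))
  exact (Set.toFinite {K : BidirectedGraph n | K.transClosure = G.transClosure}).exists_minimal
    ⟨G, rfl⟩

/-- The arcs of the bidirected graph `G(x)`: selfloops `2i` and `-2i` for unsaturated elements,
and arcs `i - j`, `i + j`, `-i - j` (`i ≠ j`) given by the signed dependence function where it is
defined. -/
inductive VertexArc (f : SignedSet n → ℝ) (x : Fin n → ℝ) : (Fin n → ℤ) → Prop
  | loopPos (i : Fin n) : i ∉ satPlus f x → VertexArc f x (unitVec i + unitVec i)
  | loopNeg (i : Fin n) : i ∉ satMinus f x → VertexArc f x (-unitVec i - unitVec i)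
  | sub (i j : Fin n) : i ≠ j →
      (i ∈ satPlus f x ∧ j ∈ (depPlus f x i).1) ∨ (j ∈ satMinus f x ∧ i ∈ (depMinus f x j).2) →
      VertexArc f x (unitVec i - unitVec j)
  | add (i j : Fin n) : i ≠ j →
      (i ∈ satPlus f x ∧ j ∈ (depPlus f x i).2) ∨ (j ∈ satPlus f x ∧ i ∈ (depPlus f x j).2) →
      VertexArc f x (unitVec i + unitVec j)
  | neg (i j : Fin n) : i ≠ j →
      (i ∈ satMinus f x ∧ j ∈ (depMinus f x i).1) ∨
        (j ∈ satMinus f x ∧ i ∈ (depMinus f x j).1) →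
      VertexArc f x (-unitVec i - unitVec j)

/-- The bidirected graph `G(x) = G(F(x))`. -/
def vertexGraph (f : SignedSet n → ℝ) (x : Fin n → ℝ) : BidirectedGraph n :=
  ⟨{a | VertexArc f x a}, by
    intro a ha
    cases ha with
    | loopPos i _ => exact ⟨i, i, Or.inr (Or.inl rfl)⟩
    | loopNeg i _ => exact ⟨i, i, Or.inr (Or.inr rfl)⟩
    | sub i j h _ => exact ⟨i, j, Or.inl ⟨h, rfl⟩⟩
    | add i j _ _ => exact ⟨i, j, Or.inr (Or.inl rfl)⟩
    | neg i j _ _ => exact ⟨i, j, Or.inr (Or.inr rfl)⟩⟩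

end Bidirected

section LocalSearch

variable {n : ℕ}

/-- The indices `i ≤ j` such that `H` has an arc of type `j + i`. -/
def plusPartners (H : BidirectedGraph n) (j : Fin n) : Set (Fin n) :=
  {i | i ≤ j ∧ unitVec i + unitVec j ∈ H.1}

/-- The indices `i < j` such that `H` has an arc of type `j - i`. -/
def minusPartners (H : BidirectedGraph n) (j : Fin n) : Set (Fin n) :=
  {i | i < j ∧ unitVec j - unitVec i ∈ H.1}

/-- `a` is the arc `j^* ± i^*` that the local search selects: `j^*` is the largest `j` that occurs
in an arc `j + i` (`i ≤ j`) or `j - i` (`i < j`) of `H`; type `j^* + i` has priority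
over type `j^* - i`, and `i^*` is the largest partner of the type chosen. -/
def IsLocalSearchArc (H : BidirectedGraph n) (a : Fin n → ℤ) : Prop :=
  ∃ j i : Fin n,
    IsGreatest {k | (plusPartners H k).Nonempty ∨ (minusPartners H k).Nonempty} j ∧
    ((IsGreatest (plusPartners H j) i ∧ a = unitVec j + unitVec i) ∨
     (plusPartners H j = ∅ ∧ IsGreatest (minusPartners H j) i ∧ a = unitVec j - unitVec i))

/-- `c` is the capacity of `P_*(f)` at `x` in the direction `a`, the maximum of all `α ≥ 0`
with `x + α a ∈ P_*(f)`. -/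
def IsCapacity (f : SignedSet n → ℝ) (x : Fin n → ℝ) (a : Fin n → ℤ) (c : ℝ) : Prop :=
  IsGreatest {α : ℝ | 0 ≤ α ∧ x + α • (fun k => (a k : ℝ)) ∈ bisubPolyhedron f} c

/-- `y` is the value `g(x) = x + c(x, ±i^*, j^*) (j^* ± i^*)` of the local search function,
where `H` is the Hasse diagram at `x`. -/
def IsLocalSearchValue (f : SignedSet n → ℝ) (H : BidirectedGraph n) (x y : Fin n → ℝ) : Prop :=
  ∃ (a : Fin n → ℤ) (c : ℝ), IsLocalSearchArc H a ∧ IsCapacity f x a c ∧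
    y = x + c • (fun k => (a k : ℝ))

/-- Adjacency of vertices of a polyhedron: distinct vertices whose segment is a face. -/
def AdjacentVertices (P : Set (Fin n → ℝ)) (x y : Fin n → ℝ) : Prop :=
  x ∈ P.extremePoints ℝ ∧ y ∈ P.extremePoints ℝ ∧ x ≠ y ∧ IsExtreme ℝ P (segment ℝ x y)

end LocalSearch

/-! ### Sign vectors and closed families of signed sets -/

namespace SignedSet

variable {n : ℕ}

/-! The combinatorics at a vertex `x` is that of the tight family `F`. Bisubmodularity makes `F`
closed under `⊔` and `⊓`; extremality makes it separating: only `d = 0` vanishes on all of `F`. An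
arc is a feasible direction at `x` iff it is nonpositive on `F`; these are the `polarArcs`.

The Hasse diagram is identified in two steps. The transitive closure of `G(x)` is exactly the set of
polar arcs (`transClosure_vertexGraph`). Polar arcs are generated by those that no rule produces
from polar arcs (`transGen_irreducibleArcs`), and every generating graph contains these, so `H` is
the set of irreducible polar arcs (`IsHasseDiagram.arcs_eq`).

Adjacency rests on `exists_eq_smul_of_mem_irreducibleArcs`: an irreducible arc `a` spans an extreme
ray of the tangent cone, since a vector that vanishes on all tight sets where `a` vanishes is a
multiple of `a`. A maximal step along `a` therefore traverses an edge of the polyhedron.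

For the characterization of `x^*`, give vertex `k` the weight `k`. If `H` has no arc `i + j` and no
arc `j - i` with `i < j`, all its arcs have negative height. Both rules preserve this, so all
feasible arcs have negative height, which forces every `({i, …, n}, ∅)` to be tight. These equations
determine `x^*`. Conversely, tightness of these sets at `x^*` excludes the forbidden arcs. -/

instance : Finite (SignedSet n) :=
  Finite.of_injective (fun S : SignedSet n => (S.pos, S.neg)) fun S T h => by
    rw [Prod.mk.injEq] at h
    exact SignedSet.ext h.1 h.2

/-- The sign vector of a signed set. -/
def sgn (S : SignedSet n) (k : Fin n) : ℤ := if k ∈ S.pos then 1 else if k ∈ S.neg then -1 else 0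

lemma mem_pos_iff {S : SignedSet n} {k : Fin n} : k ∈ S.pos ↔ S.sgn k = 1 := by
  unfold sgn; split_ifs <;> simp_all

lemma mem_neg_iff {S : SignedSet n} {k : Fin n} : k ∈ S.neg ↔ S.sgn k = -1 := by
  unfold sgn
  split_ifs with h h'
  · simpa using Finset.disjoint_left.1 S.disj h
  · simpa using h'
  · simpa using h'

lemma sgn_cases (S : SignedSet n) (k : Fin n) : S.sgn k = -1 ∨ S.sgn k = 0 ∨ S.sgn k = 1 := by
  unfold sgn; split_ifs <;> simp

lemma ext_sgn {S T : SignedSet n} (h : ∀ k, S.sgn k = T.sgn k) : S = T := by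
  apply SignedSet.ext <;> ext k
  · rw [mem_pos_iff, mem_pos_iff, h]
  · rw [mem_neg_iff, mem_neg_iff, h]

lemma sgn_empty (k : Fin n) : (empty n).sgn k = 0 := by simp [sgn, empty]

lemma sgn_ofPos (X : Finset (Fin n)) (k : Fin n) : (ofPos X).sgn k = if k ∈ X then 1 else 0 := by
  simp [sgn, ofPos]

lemma sgn_reducedUnion (S T : SignedSet n) (k : Fin n) :
    (S.reducedUnion T).sgn k = if S.sgn k = T.sgn k then S.sgn k else S.sgn k + T.sgn k := by
  have h₁ : k ∈ S.pos → k ∉ S.neg := fun h => Finset.disjoint_left.1 S.disj h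
  have h₂ : k ∈ T.pos → k ∉ T.neg := fun h => Finset.disjoint_left.1 T.disj h
  by_cases a : k ∈ S.pos <;> by_cases b : k ∈ S.neg <;> by_cases c : k ∈ T.pos <;>
    by_cases d : k ∈ T.neg <;> simp_all [sgn, reducedUnion]

lemma sgn_inter (S T : SignedSet n) (k : Fin n) :
    (S.inter T).sgn k = if S.sgn k = T.sgn k then S.sgn k else 0 := by
  have h₁ : k ∈ S.pos → k ∉ S.neg := fun h => Finset.disjoint_left.1 S.disj h
  have h₂ : k ∈ T.pos → k ∉ T.neg := fun h => Finset.disjoint_left.1 T.disj h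
  by_cases a : k ∈ S.pos <;> by_cases b : k ∈ S.neg <;> by_cases c : k ∈ T.pos <;>
    by_cases d : k ∈ T.neg <;> simp_all [sgn, inter]

lemma sgn_reducedUnion_add_inter (S T : SignedSet n) (k : Fin n) :
    (S.reducedUnion T).sgn k + (S.inter T).sgn k = S.sgn k + T.sgn k := by
  rw [sgn_reducedUnion, sgn_inter]
  rcases S.sgn_cases k with h | h | h <;> rcases T.sgn_cases k with h' | h' | h' <;>
    rw [h, h'] <;> decide

lemma eval_eq_sum (d : Fin n → ℝ) (S : SignedSet n) : S.eval d = ∑ k, d k * (S.sgn k : ℝ) := by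
  have h : ∀ k, d k * (S.sgn k : ℝ) =
      (if k ∈ S.pos then d k else 0) - if k ∈ S.neg then d k else 0 := by
    intro k
    have : k ∈ S.pos → k ∉ S.neg := fun h => Finset.disjoint_left.1 S.disj h
    unfold sgn
    split_ifs <;> simp_all
  simp [eval, h, Finset.sum_sub_distrib]

lemma eval_add (d e : Fin n → ℝ) (S : SignedSet n) : S.eval (d + e) = S.eval d + S.eval e := by
  simp [eval_eq_sum, add_mul, Finset.sum_add_distrib]

lemma eval_smul (c : ℝ) (d : Fin n → ℝ) (S : SignedSet n) : S.eval (c • d) = c * S.eval d := by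
  simp [eval_eq_sum, Finset.mul_sum, mul_assoc]

lemma eval_sub (d e : Fin n → ℝ) (S : SignedSet n) : S.eval (d - e) = S.eval d - S.eval e := by
  simp [eval_eq_sum, sub_mul, Finset.sum_sub_distrib]

/-- The sign vectors of `S ⊔ T` and `S ⊓ T` add up to those of `S` and `T`, so linear functions
satisfy the bisubmodular inequality with equality. -/
lemma eval_modular (d : Fin n → ℝ) (S T : SignedSet n) :
    (S.reducedUnion T).eval d + (S.inter T).eval d = S.eval d + T.eval d := by
  simp only [eval_eq_sum, ← Finset.sum_add_distrib, ← mul_add]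
  refine Finset.sum_congr rfl fun k _ => ?_
  have := S.sgn_reducedUnion_add_inter T k
  congr 1
  exact_mod_cast this

/-- The value of an integral vector on a signed set. -/
def pair (a : Fin n → ℤ) (S : SignedSet n) : ℤ := ∑ k, a k * S.sgn k

lemma eval_intCast (a : Fin n → ℤ) (S : SignedSet n) :
    S.eval (fun k => (a k : ℝ)) = (S.pair a : ℝ) := by
  simp [eval_eq_sum, pair]

lemma pair_add (a b : Fin n → ℤ) (S : SignedSet n) : S.pair (a + b) = S.pair a + S.pair b := by
  simp [pair, add_mul, Finset.sum_add_distrib]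

lemma pair_single (i : Fin n) (s : ℤ) (S : SignedSet n) :
    S.pair (Pi.single i s) = s * S.sgn i := by
  simp [pair, Pi.single_apply]

lemma pair_smul (c : ℤ) (a : Fin n → ℤ) (S : SignedSet n) : S.pair (c • a) = c * S.pair a := by
  simp [pair, Finset.mul_sum, mul_assoc]

lemma eval_single (i : Fin n) (s : ℝ) (S : SignedSet n) :
    S.eval (Pi.single i s) = s * S.sgn i := by
  simp [eval_eq_sum, Pi.single_apply]

/-- Componentwise inclusion of signed sets. -/
def Sub (S T : SignedSet n) : Prop := ∀ k, S.sgn k ≠ 0 → T.sgn k = S.sgn k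

/-- A family of signed sets that contains `(∅, ∅)` and is closed under `⊔` and `⊓`. -/
structure IsClosedFamily (F : Set (SignedSet n)) : Prop where
  empty_mem : empty n ∈ F
  union_mem : ∀ S ∈ F, ∀ T ∈ F, S.reducedUnion T ∈ F
  inter_mem : ∀ S ∈ F, ∀ T ∈ F, S.inter T ∈ F

/-- The number of elements of a signed set. -/
def size (S : SignedSet n) : ℕ := (Finset.univ.filter fun k => S.sgn k ≠ 0).card

lemma size_lt {S T : SignedSet n} (h : S.Sub T) {k : Fin n} (hS : S.sgn k = 0)
    (hT : T.sgn k ≠ 0) : S.size < T.size := by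
  refine Finset.card_lt_card (Finset.ssubset_iff_of_subset ?_ |>.2 ⟨k, by simp [hT], by simp [hS]⟩)
  intro l hl
  simp only [Finset.mem_filter, Finset.mem_univ, true_and] at hl ⊢
  rwa [h l hl]

lemma inter_sub_left (S T : SignedSet n) : (S.inter T).Sub S := by
  intro k hk
  rw [sgn_inter] at hk ⊢
  split_ifs at hk ⊢ with h <;> simp_all

lemma inter_sub_right (S T : SignedSet n) : (S.inter T).Sub T := by
  intro k hk
  rw [sgn_inter] at hk ⊢
  split_ifs at hk ⊢ with h <;> simp_all

/-- The least member of a closed family with a prescribed nonzero sign. -/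
lemma IsClosedFamily.exists_least {F : Set (SignedSet n)} (hF : IsClosedFamily F) {i : Fin n}
    {s : ℤ} (h : ∃ S ∈ F, S.sgn i = s) :
    ∃ D ∈ F, D.sgn i = s ∧ ∀ S ∈ F, S.sgn i = s → D.Sub S := by
  obtain ⟨D, ⟨hD, hDi⟩, hmin⟩ := Set.exists_min_image {S | S ∈ F ∧ S.sgn i = s} size
    (Set.toFinite _) h
  refine ⟨D, hD, hDi, fun S hS hSi => ?_⟩
  have hm := hmin (D.inter S) ⟨hF.inter_mem D hD S hS, by rw [sgn_inter, hDi, hSi, if_pos rfl]⟩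
  intro k hk
  by_contra hne
  refine absurd (size_lt (k := k) (inter_sub_left D S) ?_ hk) (not_lt.2 hm)
  rw [sgn_inter, if_neg (Ne.symm hne)]

/-- A signed set that is covered by members of a closed family below it is a member. -/
lemma IsClosedFamily.mem_of_cover {F : Set (SignedSet n)} (hF : IsClosedFamily F)
    (D : SignedSet n) (h : ∀ k, D.sgn k ≠ 0 → ∃ S ∈ F, S.Sub D ∧ S.sgn k = D.sgn k) : D ∈ F := by
  have key : ∀ K : Finset (Fin n), ∃ S ∈ F, S.Sub D ∧ ∀ k ∈ K, S.sgn k = D.sgn k := by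
    intro K
    induction K using Finset.induction_on with
    | empty => exact ⟨empty n, hF.empty_mem, fun k hk => absurd (sgn_empty k) hk, by simp⟩
    | insert k K _ ih =>
      obtain ⟨S, hS, hSD, hSK⟩ := ih
      obtain ⟨T, hT, hTD, hTk⟩ : ∃ T ∈ F, T.Sub D ∧ T.sgn k = D.sgn k := by
        by_cases hk : D.sgn k = 0
        · exact ⟨empty n, hF.empty_mem, fun k hk => absurd (sgn_empty k) hk, by
            rw [hk, sgn_empty]⟩
        · exact h k hk
      have hsg : ∀ l, (S.sgn l = 0 ∨ S.sgn l = D.sgn l) ∧ (T.sgn l = 0 ∨ T.sgn l = D.sgn l) :=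
        fun l => ⟨or_iff_not_imp_left.2 fun h => (hSD l h).symm,
          or_iff_not_imp_left.2 fun h => (hTD l h).symm⟩
      -- Below `D` signs never conflict, so the reduced union is an ordinary union and loses no
      -- element.
      have hu : ∀ l, (S.reducedUnion T).sgn l = if S.sgn l = 0 then T.sgn l else S.sgn l := by
        intro l
        rw [sgn_reducedUnion]
        rcases D.sgn_cases l with hd | hd | hd <;> rcases hsg l with ⟨h1 | h1, h2 | h2⟩ <;>
          simp [h1, h2, hd]
      refine ⟨_, hF.union_mem S hS T hT, fun l hl => ?_, fun l hl => ?_⟩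
      · rw [hu] at hl ⊢
        split_ifs at hl ⊢ with h0
        · exact hTD l hl
        · exact hSD l hl
      · rw [hu]
        rcases Finset.mem_insert.1 hl with rfl | hl
        · split_ifs with h0
          · exact hTk
          · exact (hSD l h0).symm
        · split_ifs with h0
          · rcases (hsg l).2 with h1 | h1
            · rw [h1, ← hSK l hl, h0]
            · exact h1
          · exact hSK l hl
  obtain ⟨S, hS, _, hSK⟩ := key Finset.univ
  rwa [← ext_sgn fun k => hSK k (Finset.mem_univ k)]

/-- If every member of a closed family with sign `s` at `i` has sign `-t` at `j`, then the arc
`s i + t j` is nonpositive on the family. -/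
lemma IsClosedFamily.nonpos_of_imp {F : Set (SignedSet n)} (hF : IsClosedFamily F) {i j : Fin n}
    {s t : ℤ} (hs : s = 1 ∨ s = -1) (ht : t = 1 ∨ t = -1) (hex : ∃ S ∈ F, S.sgn i = s)
    (h : ∀ S ∈ F, S.sgn i = s → S.sgn j = -t) :
    ∀ S ∈ F, s * S.sgn i + t * S.sgn j ≤ 0 := by
  intro S hS
  obtain ⟨D, hD, hDi⟩ := hex
  have h1 := h S hS
  have h2 := h D hD hDi
  -- The case to exclude is sign `0` at `i` and `t` at `j`: then `S ⊔ D` would have sign `s` at `i`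
  -- but `0` at `j`, against `h`.
  have h3 := h _ (hF.union_mem S hS D hD)
  rw [sgn_reducedUnion, sgn_reducedUnion, hDi, h2] at h3
  rcases hs with rfl | rfl <;> rcases ht with rfl | rfl <;>
    rcases S.sgn_cases i with hi | hi | hi <;> rcases S.sgn_cases j with hj | hj | hj <;>
    simp_all 

end SignedSet

/-! ### Arcs and loops whose faces determine a direction -/

namespace SignedSet

variable {n : ℕ}

/-- The restriction of a signed set to the elements that satisfy `p`. -/
def restrict (S : SignedSet n) (p : Fin n → Prop) [DecidablePred p] : SignedSet n where
  pos := S.pos.filter p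
  neg := S.neg.filter p
  disj := Finset.disjoint_filter_filter S.disj

lemma sgn_restrict (S : SignedSet n) (p : Fin n → Prop) [DecidablePred p] (k : Fin n) :
    (S.restrict p).sgn k = if p k then S.sgn k else 0 := by
  by_cases h : p k <;> simp [sgn, restrict, h]

lemma sgn_inter_eq_zero (S : SignedSet n) {T : SignedSet n} {k : Fin n} (h : T.sgn k = 0) :
    (S.inter T).sgn k = 0 := by
  rw [sgn_inter, h]; split_ifs with h' <;> simp [h']

lemma eval_congr {d : Fin n → ℝ} {S T : SignedSet n} (h : ∀ k, d k ≠ 0 → S.sgn k = T.sgn k) :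
    S.eval d = T.eval d := by
  rw [eval_eq_sum, eval_eq_sum]
  refine Finset.sum_congr rfl fun k _ => ?_
  by_cases hk : d k = 0
  · simp [hk]
  · rw [h k hk]

/-- The core of the extreme ray property for arcs with two ends; `hdec` says that the arc is not a
sum of two polar arcs through a third vertex `k`. Let `D` be the least member with sign `s` at `i`.
Indecomposability puts `D` without `i, j` into the family, and comparing the two members gives `d j
= 0`. Then taking `⊔` with `D` does not change the value of `d`, and doing so twice moves any member
into the face of the arc. -/
lemma IsClosedFamily.eval_eq_zero_of_arc {F : Set (SignedSet n)} (hF : IsClosedFamily F)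
    {i j : Fin n} (hij : i ≠ j) {s t : ℤ} (hs : s = 1 ∨ s = -1) (ht : t = 1 ∨ t = -1)
    (hex : ∃ S ∈ F, S.sgn i = s) (ha : ∀ S ∈ F, s * S.sgn i + t * S.sgn j ≤ 0)
    (hdec : ∀ k, ∀ r : ℤ, k ≠ i → k ≠ j → r = 1 ∨ r = -1 →
      ¬ ((∀ S ∈ F, s * S.sgn i + -r * S.sgn k ≤ 0) ∧ ∀ S ∈ F, r * S.sgn k + t * S.sgn j ≤ 0))
    {d : Fin n → ℝ} (hdi : d i = 0)
    (hd : ∀ S ∈ F, s * S.sgn i + t * S.sgn j = 0 → S.eval d = 0) :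
    ∀ S ∈ F, S.eval d = 0 := by
  obtain ⟨D, hD, hDi, hDmin⟩ := hF.exists_least hex
  have hfor : ∀ S ∈ F, S.sgn i = s → S.sgn j = -t := by
    intro S hS hSi
    have := ha S hS
    rw [hSi] at this
    rcases hs with rfl | rfl <;> rcases ht with rfl | rfl <;>
      rcases S.sgn_cases j with h | h | h <;> simp_all
  have hDj := hfor D hD hDi
  set D₀ := D.restrict fun k => k ≠ i ∧ k ≠ j with hD₀
  have hD₀F : D₀ ∈ F := by
    refine hF.mem_of_cover _ fun k hk => ?_
    rw [hD₀, sgn_restrict] at hk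
    obtain ⟨⟨hki, hkj⟩, hDk⟩ : (k ≠ i ∧ k ≠ j) ∧ D.sgn k ≠ 0 := by
      by_contra hcon
      apply hk
      split_ifs with h1
      · by_contra h2; exact hcon ⟨h1, h2⟩
      · rfl
    have hr : D.sgn k = 1 ∨ D.sgn k = -1 := by
      rcases D.sgn_cases k with h | h | h <;> simp_all
    have hkex : ∃ S ∈ F, S.sgn k = D.sgn k := ⟨D, hD, rfl⟩
    obtain ⟨E, hE, hEk, hEmin⟩ := hF.exists_least hkex
    have hED := hEmin D hD rfl
    have h1 : ∀ S ∈ F, s * S.sgn i + -D.sgn k * S.sgn k ≤ 0 :=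
      hF.nonpos_of_imp hs (by rcases hr with h | h <;> simp [h]) hex fun S hS hSi => by
        rw [hDmin S hS hSi k hDk, neg_neg]
    -- The arc from `i` to `k` is polar because `D` is least, so by `hdec` the arc from `k` to `j`
    -- is not. Hence the least member `E` at `k` avoids `j`, and then also `i`.
    have h2 : ∃ S ∈ F, S.sgn k = D.sgn k ∧ S.sgn j ≠ -t := by
      by_contra! hcon
      exact hdec k _ hki hkj hr ⟨h1, hF.nonpos_of_imp hr ht hkex hcon⟩
    obtain ⟨S, hS, hSk, hSj⟩ := h2
    have hEj : E.sgn j = 0 := by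
      by_contra h
      exact hSj (by rw [hEmin S hS hSk j h, ← hED j h, hDj])
    have hEi : E.sgn i = 0 := by
      by_contra h
      have := hfor E hE (by rw [← hED i h, hDi])
      rw [hEj] at this
      rcases ht with rfl | rfl <;> simp at this
    refine ⟨E, hE, fun l hl => ?_, ?_⟩
    · rw [hD₀, sgn_restrict, if_pos]
      · exact hED l hl
      · constructor
        · rintro rfl; exact hl hEi
        · rintro rfl; exact hl hEj
    · rw [hD₀, sgn_restrict, if_pos ⟨hki, hkj⟩, hEk]
  have hD₀i : D₀.sgn i = 0 := by rw [hD₀, sgn_restrict, if_neg (by simp)]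
  have hD₀j : D₀.sgn j = 0 := by rw [hD₀, sgn_restrict, if_neg (by simp)]
  have hD₀k : ∀ k, k ≠ i → k ≠ j → D₀.sgn k = D.sgn k := fun k h h' => by
    rw [hD₀, sgn_restrict, if_pos ⟨h, h'⟩]
  have hdD : D.eval d = 0 := hd D hD (by
    rw [hDi, hDj]; rcases hs with rfl | rfl <;> rcases ht with rfl | rfl <;> norm_num)
  have hdj : d j = 0 := by
    have h1 : D.eval d - D₀.eval d = d j * D.sgn j := by
      rw [eval_eq_sum, eval_eq_sum, ← Finset.sum_sub_distrib, Finset.sum_eq_single j]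
      · simp [hD₀j]
      · intro k _ hk
        by_cases hki : k = i
        · subst hki; simp [hdi]
        · rw [hD₀k k hki hk, sub_self]
      · simp
    rw [hdD, hd D₀ hD₀F (by simp [hD₀i, hD₀j]), hDj, sub_zero] at h1
    rcases ht with rfl | rfl <;> simpa using h1.symm
  have hunion : ∀ X ∈ F, X.eval d = (X.reducedUnion D).eval d := by
    intro X hX
    have h1 := eval_modular d X D
    have h2 : (X.inter D).eval d = 0 := by
      rw [← hd (X.inter D₀) (hF.inter_mem X hX D₀ hD₀F)]
      · refine eval_congr fun k hk => ?_
        rw [sgn_inter, sgn_inter, hD₀k k (by rintro rfl; exact hk hdi) (by rintro rfl; exact hk hdj)]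
      · rw [sgn_inter_eq_zero X hD₀i, sgn_inter_eq_zero X hD₀j]; simp
    linarith
  intro X hX
  have hXD := hF.union_mem X hX D hD
  -- One union with `D` may only cancel opposite signs at `i` and `j`; the second produces `s` and
  -- `-t`.
  rw [hunion X hX, hunion _ hXD]
  refine hd _ (hF.union_mem _ hXD D hD) ?_
  have := ha X hX
  simp only [sgn_reducedUnion, hDi, hDj]
  rcases hs with rfl | rfl <;> rcases ht with rfl | rfl <;>
    rcases X.sgn_cases i with h | h | h <;> rcases X.sgn_cases j with h' | h' | h' <;>
    simp [h, h'] at this ⊢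

/-- The analogue for a selfloop at `i`, by induction on the size of `X`. If a member `S` avoiding
`i` is opposite to `X` somewhere, the modular identities for `X ⊔ S` and `(X ⊔ S) ⊔ X` give the
value of `d` at `X` as twice itself. Otherwise the members avoiding `i` cover `X` without `i`, which
is then a member with the same value since `d i = 0`. -/
lemma IsClosedFamily.eval_eq_zero_of_loop {F : Set (SignedSet n)} (hF : IsClosedFamily F)
    {i : Fin n} (hdec : ∀ k ≠ i, ∃ S ∈ F, S.sgn i = 0 ∧ S.sgn k ≠ 0)
    {d : Fin n → ℝ} (hdi : d i = 0) (hd : ∀ S ∈ F, S.sgn i = 0 → S.eval d = 0) :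
    ∀ X ∈ F, X.eval d = 0 := by
  intro X
  induction hN : X.size using Nat.strong_induction_on generalizing X with
  | _ N ih =>
  intro hX
  by_cases hXi : X.sgn i = 0
  · exact hd X hX hXi
  by_cases hopp : ∃ S ∈ F, ∃ k, S.sgn i = 0 ∧ X.sgn k ≠ 0 ∧ S.sgn k = -X.sgn k
  · obtain ⟨S, hS, k, hSi, hXk, hSk⟩ := hopp
    have hU := hF.union_mem X hX S hS
    have e₁ := eval_modular d X S
    have e₂ := eval_modular d (X.reducedUnion S) X
    have e₃ := eval_modular d S ((X.reducedUnion S).reducedUnion X)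
    have z₁ : (X.inter S).eval d = 0 := hd _ (hF.inter_mem X hX S hS) (by simp [sgn_inter, hSi])
    have z₂ : (S.inter ((X.reducedUnion S).reducedUnion X)).eval d = 0 :=
      hd _ (hF.inter_mem S hS _ (hF.union_mem _ hU X hX)) (by simp [sgn_inter, hSi])
    have z₃ : ((X.reducedUnion S).inter X).eval d = 0 := by
      refine ih _ ?_ _ rfl (hF.inter_mem _ hU X hX)
      rw [← hN]
      refine size_lt (k := k) (inter_sub_right _ _) ?_ hXk
      rw [sgn_inter, sgn_reducedUnion, hSk]
      rcases X.sgn_cases k with h | h | h <;> simp [h]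
    -- This closes the cycle: `d` takes the same value at `X`, `X ⊔ S` and `(X ⊔ S) ⊔ X`, while the
    -- last is twice the value at `X`.
    have hEq : S.reducedUnion ((X.reducedUnion S).reducedUnion X) = X.reducedUnion S := by
      refine ext_sgn fun l => ?_
      simp only [sgn_reducedUnion]
      rcases X.sgn_cases l with h | h | h <;> rcases S.sgn_cases l with h' | h' | h' <;>
        simp [h, h']
    rw [hEq] at e₃
    have := hd S hS hSi
    linarith
  · have hR : X.restrict (· ≠ i) ∈ F := by
      refine hF.mem_of_cover _ fun k hk => ?_
      rw [sgn_restrict] at hk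
      have hki : k ≠ i := by rintro rfl; simp at hk
      rw [if_pos hki] at hk
      obtain ⟨S, hS, hSi, hSk⟩ := hdec k hki
      have hSX : S.sgn k = X.sgn k := by
        have : S.sgn k ≠ -X.sgn k := fun h => hopp ⟨S, hS, k, hSi, hk, h⟩
        rcases X.sgn_cases k with h | h | h <;> rcases S.sgn_cases k with h' | h' | h' <;>
          simp_all
      refine ⟨S.inter X, hF.inter_mem S hS X hX, fun l hl => ?_, ?_⟩
      · rw [sgn_restrict, if_pos]
        · exact inter_sub_right S X l hl
        · rintro rfl
          simp [sgn_inter, hSi] at hl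
      · rw [sgn_inter, sgn_restrict, if_pos hki, if_pos hSX, hSX]
    rw [← hd _ hR (by simp [sgn_restrict])]
    refine eval_congr fun k hk => ?_
    rw [sgn_restrict, if_pos]
    rintro rfl
    exact hk hdi

end SignedSet

/-! ### Polar arcs and irreducible arcs -/

section Arcs

variable {n : ℕ}

open SignedSet

lemma isArcBoundary_iff {a : Fin n → ℤ} : IsArcBoundary a ↔ ∃ (i j : Fin n) (s t : ℤ),
    (s = 1 ∨ s = -1) ∧ (t = 1 ∨ t = -1) ∧ (i = j → s = t) ∧
      a = Pi.single i s + Pi.single j t := by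
  have hneg : ∀ i : Fin n, -unitVec i = Pi.single i (-1) := fun i => by
    rw [unitVec, Pi.single_neg]
  constructor
  · rintro ⟨i, j, ⟨hij, rfl⟩ | rfl | rfl⟩
    · exact ⟨i, j, 1, -1, by simp, by simp, fun h => absurd h hij, by rw [sub_eq_add_neg, hneg]; rfl⟩
    · exact ⟨i, j, 1, 1, by simp, by simp, fun _ => rfl, rfl⟩
    · exact ⟨i, j, -1, -1, by simp, by simp, fun _ => rfl, by rw [sub_eq_add_neg, hneg, hneg]⟩
  · rintro ⟨i, j, s, t, rfl | rfl, rfl | rfl, h, rfl⟩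
    · exact ⟨i, j, Or.inr (Or.inl rfl)⟩
    · exact ⟨i, j, Or.inl ⟨fun e => by simpa using h e, by rw [sub_eq_add_neg, hneg]; rfl⟩⟩
    · exact ⟨j, i, Or.inl ⟨fun e => by simpa using h e.symm, by
        rw [sub_eq_add_neg, hneg, add_comm]; rfl⟩⟩
    · exact ⟨i, j, Or.inr (Or.inr (by rw [sub_eq_add_neg, hneg, hneg]))⟩

lemma isSelfloopAt_single {i : Fin n} {s : ℤ} (hs : s = 1 ∨ s = -1) :
    IsSelfloopAt (Pi.single i s + Pi.single i s) i := by
  rcases hs with rfl | rfl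
  · left; rw [two_smul]; rfl
  · right; rw [two_smul, neg_add, unitVec, Pi.single_neg]

lemma not_isSelfloopAt {i k : Fin n} (hik : i ≠ k) {s r : ℤ} (hs : s = 1 ∨ s = -1) (l : Fin n) :
    ¬ IsSelfloopAt (Pi.single i s + Pi.single k r) l := by
  rintro (h | h) <;>
  · have := congrFun h i
    simp only [unitVec, Pi.add_apply, Pi.single_eq_same, Pi.single_eq_of_ne hik, Pi.smul_apply,
      Pi.neg_apply, Pi.single_apply] at this
    rcases hs with rfl | rfl <;> split_ifs at this <;> simp at this

lemma IsSelfloopAt.exists_eq {a : Fin n → ℤ} {i : Fin n} (h : IsSelfloopAt a i) :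
    ∃ s : ℤ, (s = 1 ∨ s = -1) ∧ a = Pi.single i s + Pi.single i s := by
  rcases h with rfl | rfl
  · exact ⟨1, by simp, by rw [two_smul]; rfl⟩
  · exact ⟨-1, by simp, by rw [two_smul, neg_add, unitVec, Pi.single_neg]⟩

/-- The arcs that are nonpositive on a family of signed sets. -/
def polarArcs (F : Set (SignedSet n)) : Set (Fin n → ℤ) :=
  {a | IsArcBoundary a ∧ ∀ S ∈ F, S.pair a ≤ 0}

lemma pair_arc (i j : Fin n) (s t : ℤ) (S : SignedSet n) :
    S.pair (Pi.single i s + Pi.single j t) = s * S.sgn i + t * S.sgn j := by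
  rw [pair_add, pair_single, pair_single]

lemma mem_polarArcs {F : Set (SignedSet n)} {i j : Fin n} {s t : ℤ} (hs : s = 1 ∨ s = -1)
    (ht : t = 1 ∨ t = -1) (hij : i = j → s = t) (h : ∀ S ∈ F, s * S.sgn i + t * S.sgn j ≤ 0) :
    (Pi.single i s + Pi.single j t : Fin n → ℤ) ∈ polarArcs F :=
  ⟨isArcBoundary_iff.2 ⟨i, j, s, t, hs, ht, hij, rfl⟩, fun S hS => by
    rw [pair_arc]; exact h S hS⟩

lemma loop_mem_polarArcs {F : Set (SignedSet n)} {k : Fin n} {r : ℤ} (hr : r = 1 ∨ r = -1)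
    (h : ¬ ∃ S ∈ F, S.sgn k = r) : Pi.single k r + Pi.single k r ∈ polarArcs F := by
  refine mem_polarArcs hr hr (fun _ => rfl) fun S hS => ?_
  have hne : S.sgn k ≠ r := fun e => h ⟨S, hS, e⟩
  rcases hr with rfl | rfl <;> rcases S.sgn_cases k with h' | h' | h' <;>
    simp [h'] at hne ⊢

/-- The arc `a` arises from arcs of `A` by the rule `trans`. -/
def IsTransSum (A : Set (Fin n → ℤ)) (a : Fin n → ℤ) : Prop :=
  ∃ b ∈ A, ∃ b' ∈ A, ∃ v, ¬ ((∃ i, IsSelfloopAt b i) ∧ ∃ i, IsSelfloopAt b' i) ∧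
    b v * b' v < 0 ∧ b + b' = a

/-- The arc `a` arises from arcs of `A` by the rule `loops`. -/
def IsLoopMean (A : Set (Fin n → ℤ)) (a : Fin n → ℤ) : Prop :=
  ∃ b ∈ A, ∃ b' ∈ A, ∃ i j, i ≠ j ∧ IsSelfloopAt b i ∧ IsSelfloopAt b' j ∧ (2 : ℤ) • a = b + b'

/-- The arcs of `A` that do not arise from arcs of `A` by a transitivity rule. -/
def irreducibleArcs (A : Set (Fin n → ℤ)) : Set (Fin n → ℤ) :=
  {a | a ∈ A ∧ ¬ IsTransSum A a ∧ ¬ IsLoopMean A a}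

lemma isTransSum_of_middle {A : Set (Fin n → ℤ)} {i j k : Fin n} {s t r : ℤ}
    (hs : s = 1 ∨ s = -1) (hr : r = 1 ∨ r = -1) (hik : k ≠ i) (hjk : k ≠ j)
    (h₁ : Pi.single i s + Pi.single k (-r) ∈ A) (h₂ : Pi.single k r + Pi.single j t ∈ A) :
    IsTransSum A (Pi.single i s + Pi.single j t) := by
  refine ⟨_, h₁, _, h₂, k, fun h => ?_, ?_, ?_⟩
  · obtain ⟨l, hl⟩ := h.1
    exact not_isSelfloopAt hik.symm hs l hl
  · simp only [Pi.add_apply, Pi.single_eq_same, Pi.single_eq_of_ne hik, Pi.single_eq_of_ne hjk]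
    rcases hr with rfl | rfl <;> norm_num
  · rw [Pi.single_neg]; abel

/-- The irreducible polar arcs span the faces that they generate. -/
lemma exists_eq_smul_of_mem_irreducibleArcs {F : Set (SignedSet n)} (hF : IsClosedFamily F)
    (hsep : ∀ d : Fin n → ℝ, (∀ S ∈ F, S.eval d = 0) → d = 0) {a : Fin n → ℤ}
    (ha : a ∈ irreducibleArcs (polarArcs F)) (d : Fin n → ℝ)
    (hd : ∀ S ∈ F, S.pair a = 0 → S.eval d = 0) :
    ∃ c : ℝ, d = c • fun k => (a k : ℝ) := by
  obtain ⟨⟨harc, hneg⟩, htr, hlm⟩ := ha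
  -- Subtracting `(d i / a i) • a` kills the coordinate `i` and keeps the values on the face of `a`;
  -- separation then finishes.
  suffices h : ∃ i, a i ≠ 0 ∧ ∀ e : Fin n → ℝ, e i = 0 →
      (∀ S ∈ F, S.pair a = 0 → S.eval e = 0) → ∀ S ∈ F, S.eval e = 0 by
    obtain ⟨i, hai, h⟩ := h
    refine ⟨d i / a i, ?_⟩
    rw [← sub_eq_zero]
    refine hsep _ (h _ ?_ fun S hS hSa => ?_)
    · have : (a i : ℝ) ≠ 0 := by exact_mod_cast hai
      simp [this]
    · rw [eval_sub, eval_smul, eval_intCast, hSa, hd S hS hSa]; simp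
  have hcase : ∀ (i j : Fin n) (s t : ℤ), i ≠ j → (s = 1 ∨ s = -1) → (t = 1 ∨ t = -1) →
      a = Pi.single i s + Pi.single j t → (∃ S ∈ F, S.sgn i = s) → ∃ i, a i ≠ 0 ∧
      ∀ e : Fin n → ℝ, e i = 0 → (∀ S ∈ F, S.pair a = 0 → S.eval e = 0) →
        ∀ S ∈ F, S.eval e = 0 := by
    rintro i j s t hij hs ht rfl hex
    refine ⟨i, ?_, fun e hei he => hF.eval_eq_zero_of_arc hij hs ht hex (fun S hS => ?_) ?_ hei
      fun S hS h => he S hS (by rw [pair_arc, h])⟩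
    · simp only [Pi.add_apply, Pi.single_eq_same, Pi.single_eq_of_ne hij]
      rcases hs with rfl | rfl <;> norm_num
    · rw [← pair_arc]; exact hneg S hS
    · rintro k r hki hkj hr ⟨h₁, h₂⟩
      exact htr (isTransSum_of_middle hs hr hki hkj
        (mem_polarArcs hs (by rcases hr with h | h <;> simp [h]) (fun h => absurd h.symm hki) h₁)
        (mem_polarArcs hr ht (fun h => absurd h hkj) h₂))
  obtain ⟨i, j, s, t, hs, ht, hij', hae⟩ := isArcBoundary_iff.1 harc
  by_cases hij : i = j
  · subst hij
    obtain rfl := hij' rfl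
    subst hae
    refine ⟨i, ?_, fun e hei he => hF.eval_eq_zero_of_loop (fun k hk => ?_) hei
      fun S hS h => he S hS (by rw [pair_arc, h]; simp)⟩
    · simp only [Pi.add_apply, Pi.single_eq_same]
      rcases hs with rfl | rfl <;> norm_num
    -- If every member avoiding `i` also avoids `k`, then `s i + k` and `s i - k` are both polar,
    -- and the loop is their sum.
    · by_contra! hcon
      have hle : ∀ r : ℤ, r = 1 ∨ r = -1 → ∀ S ∈ F, s * S.sgn i + r * S.sgn k ≤ 0 := by
        intro r hr S hS
        have h1 := hneg S hS
        have h2 := hcon S hS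
        rw [pair_arc] at h1
        rcases hs with rfl | rfl <;> rcases hr with rfl | rfl <;>
          rcases S.sgn_cases i with h | h | h <;> rcases S.sgn_cases k with h' | h' | h' <;>
          simp [h, h'] at h1 h2 ⊢
      refine htr (isTransSum_of_middle (r := 1) hs (Or.inl rfl) hk hk
        (mem_polarArcs hs (by simp) (fun h => absurd h.symm hk) (hle _ (by simp)))
        (mem_polarArcs (by simp) hs (fun h => absurd h hk) fun S hS => ?_))
      rw [add_comm]
      exact hle 1 (by simp) S hS
  by_cases hi : ∃ S ∈ F, S.sgn i = s
  · exact hcase i j s t hij hs ht hae hi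
  by_cases hj : ∃ S ∈ F, S.sgn j = t
  · exact hcase j i t s (Ne.symm hij) ht hs (by rw [hae, add_comm]) hj
  -- No member has sign `s` at `i` or sign `t` at `j`, so both selfloops are polar and `a` is their
  -- mean.
  refine absurd ?_ hlm
  refine ⟨_, loop_mem_polarArcs hs hi, _, loop_mem_polarArcs ht hj, i, j, hij, isSelfloopAt_single hs,
    isSelfloopAt_single ht, ?_⟩
  rw [hae, two_smul]; abel

end Arcs

/-! ### Generation by irreducible arcs and the Hasse diagram -/

section Arcs

variable {n : ℕ}

open SignedSet

/-- The polar arcs are closed under the transitivity rules. -/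
lemma TransGen.mem_polarArcs {F : Set (SignedSet n)} {A : Set (Fin n → ℤ)}
    (hA : A ⊆ polarArcs F) {a : Fin n → ℤ} (h : TransGen A a) : a ∈ polarArcs F := by
  induction h with
  | base h => exact hA h
  | trans v _ _ _ _ h ih ih' =>
    exact ⟨h, fun S hS => by rw [pair_add]; exact add_nonpos (ih.2 S hS) (ih'.2 S hS)⟩
  | loops i j _ _ _ _ _ h h2 ih ih' =>
    refine ⟨h, fun S hS => ?_⟩
    have h1 := congrArg (fun c => S.pair c) h2
    simp only [pair_smul, pair_add] at h1
    have := ih.2 S hS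
    have := ih'.2 S hS
    linarith

lemma arc_ne_zero {a : Fin n → ℤ} (ha : IsArcBoundary a) : a ≠ 0 := by
  obtain ⟨i, j, s, t, hs, ht, hij, rfl⟩ := isArcBoundary_iff.1 ha
  intro h
  have h1 := congrFun h i
  simp only [Pi.add_apply, Pi.single_eq_same, Pi.single_apply, Pi.zero_apply] at h1
  split_ifs at h1 with h2
  · have := hij h2
    rcases hs with rfl | rfl <;> simp [← this] at h1
  · rcases hs with rfl | rfl <;> simp at h1

lemma exists_pair_neg {F : Set (SignedSet n)}
    (hsep : ∀ d : Fin n → ℝ, (∀ S ∈ F, S.eval d = 0) → d = 0) {a : Fin n → ℤ}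
    (ha : a ∈ polarArcs F) : ∃ S ∈ F, S.pair a < 0 := by
  by_contra! h
  refine arc_ne_zero ha.1 (funext fun k => ?_)
  have := congrFun (hsep (fun k => (a k : ℝ)) fun S hS => by
    rw [eval_intCast, le_antisymm (ha.2 S hS) (h S hS)]; simp) k
  simpa using this

/-- A mean of two selfloops is a sum of two polar arcs if it generates the same face as one of
the selfloops. -/
lemma isTransSum_of_loopMean {F : Set (SignedSet n)} {i j : Fin n} {s t : ℤ} (hij : i ≠ j)
    (hs : s = 1 ∨ s = -1) (ht : t = 1 ∨ t = -1)
    (hi : Pi.single i s + Pi.single i s ∈ polarArcs F)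
    (hj : Pi.single j t + Pi.single j t ∈ polarArcs F)
    (h : ∀ S ∈ F, S.sgn i = 0 → S.sgn j = 0) :
    IsTransSum (polarArcs F) (Pi.single i s + Pi.single j t) := by
  -- The decomposition is `(s i - t j) + 2 t j`; by `h` the first summand is polar.
  refine ⟨_, _root_.mem_polarArcs (i := i) (j := j) (t := -t) hs
    (by rcases ht with h | h <;> simp [h]) (fun h => absurd h hij) fun S hS => ?_, _, hj, j, ?_, ?_, ?_⟩
  · have h1 := hi.2 S hS
    have h2 := hj.2 S hS
    have h3 := h S hS
    rw [pair_arc] at h1 h2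
    rcases hs with rfl | rfl <;> rcases ht with rfl | rfl <;>
      rcases S.sgn_cases i with h | h | h <;> rcases S.sgn_cases j with h' | h' | h' <;>
      simp [h, h'] at h1 h2 h3 ⊢
  · rintro ⟨⟨l, hl⟩, -⟩
    exact not_isSelfloopAt hij hs l hl
  · simp only [Pi.add_apply, Pi.single_eq_same, Pi.single_eq_of_ne hij.symm]
    rcases ht with rfl | rfl <;> norm_num
  · rw [Pi.single_neg]; abel

/-- The members of `F` at which an arc does not vanish. -/
noncomputable def activeMembers (F : Set (SignedSet n)) (a : Fin n → ℤ) : Finset (SignedSet n) :=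
  (Set.toFinite {S | S ∈ F ∧ S.pair a ≠ 0}).toFinset

lemma mem_activeMembers {F : Set (SignedSet n)} {a : Fin n → ℤ} {S : SignedSet n} :
    S ∈ activeMembers F a ↔ S ∈ F ∧ S.pair a ≠ 0 := by
  simp [activeMembers]

/-- The total weight of an arc with respect to a family of signed sets. -/
noncomputable def arcWeight (F : Set (SignedSet n)) (a : Fin n → ℤ) : ℤ :=
  -∑ S ∈ (Set.toFinite F).toFinset, S.pair a

lemma arcWeight_add (F : Set (SignedSet n)) (a b : Fin n → ℤ) :
    arcWeight F (a + b) = arcWeight F a + arcWeight F b := by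
  simp only [arcWeight, pair_add, Finset.sum_add_distrib, neg_add]

lemma arcWeight_pos {F : Set (SignedSet n)}
    (hsep : ∀ d : Fin n → ℝ, (∀ S ∈ F, S.eval d = 0) → d = 0) {a : Fin n → ℤ}
    (ha : a ∈ polarArcs F) : 0 < arcWeight F a := by
  obtain ⟨S, hS, h⟩ := exists_pair_neg hsep ha
  rw [arcWeight, neg_pos]
  exact Finset.sum_neg' (fun T hT => ha.2 T (by simpa using hT)) ⟨S, by simpa using hS, h⟩

/-- The polar arcs of a separating family are generated by the irreducible ones. -/
lemma transGen_irreducibleArcs {F : Set (SignedSet n)}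
    (hsep : ∀ d : Fin n → ℝ, (∀ S ∈ F, S.eval d = 0) → d = 0) (a : Fin n → ℤ)
    (ha : a ∈ polarArcs F) : TransGen (irreducibleArcs (polarArcs F)) a := by
  -- In a sum of polar arcs, neither summand has new active members, and since weights are positive
  -- and additive each summand has smaller weight. For a mean of loops the weight need not drop, but
  -- if the arc is not also a sum, each loop vanishes at some active member of the arc.
  induction h : toLex ((activeMembers F a).card, (arcWeight F a).toNat)
    using WellFoundedLT.induction generalizing a with
  | _ m ih =>
  subst h
  by_cases htr : IsTransSum (polarArcs F) a
  · obtain ⟨b, hb, b', hb', v, hl, hv, rfl⟩ := htr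
    have w₁ := arcWeight_pos hsep hb
    have w₂ := arcWeight_pos hsep hb'
    have w₃ := arcWeight_add F b b'
    have hsub : activeMembers F b ⊆ activeMembers F (b + b') ∧
        activeMembers F b' ⊆ activeMembers F (b + b') := by
      constructor <;>
      · intro S hS
        rw [mem_activeMembers] at hS ⊢
        have h₁ := hb.2 S hS.1
        have h₂ := hb'.2 S hS.1
        refine ⟨hS.1, ?_⟩
        rw [pair_add]
        have := hS.2
        omega
    refine TransGen.trans v (ih _ ?_ b hb rfl) (ih _ ?_ b' hb' rfl) hl hv ha.1
    · rw [Prod.Lex.toLex_lt_toLex]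
      rcases (Finset.card_le_card hsub.1).lt_or_eq with h | h
      · exact Or.inl h
      · exact Or.inr ⟨h, by dsimp only; omega⟩
    · rw [Prod.Lex.toLex_lt_toLex]
      rcases (Finset.card_le_card hsub.2).lt_or_eq with h | h
      · exact Or.inl h
      · exact Or.inr ⟨h, by dsimp only; omega⟩
  by_cases hlm : IsLoopMean (polarArcs F) a
  · obtain ⟨b, hb, b', hb', i, j, hij, hli, hlj, h2⟩ := hlm
    obtain ⟨s, hs, rfl⟩ := hli.exists_eq
    obtain ⟨t, ht, rfl⟩ := hlj.exists_eq
    have hae : a = Pi.single i s + Pi.single j t := by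
      funext k
      have := congrFun h2 k
      simp only [Pi.smul_apply, Pi.add_apply, smul_eq_mul] at this ⊢
      omega
    have hlt : ∀ (k l : Fin n) (r u : ℤ), (r = 1 ∨ r = -1) → (u = 1 ∨ u = -1) → k ≠ l →
        a = Pi.single k r + Pi.single l u → Pi.single k r + Pi.single k r ∈ polarArcs F →
        Pi.single l u + Pi.single l u ∈ polarArcs F →
        (activeMembers F (Pi.single k r + Pi.single k r)).card < (activeMembers F a).card := by
      rintro k l r u hr hu hkl rfl hk hl
      have hex : ∃ S ∈ F, S.sgn k = 0 ∧ S.sgn l ≠ 0 := by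
        by_contra! hcon
        exact htr (isTransSum_of_loopMean hkl hr hu hk hl hcon)
      obtain ⟨S, hS, hSk, hSl⟩ := hex
      refine Finset.card_lt_card (Finset.ssubset_iff_of_subset ?_ |>.2 ⟨S, ?_, ?_⟩)
      · intro T hT
        rw [mem_activeMembers] at hT ⊢
        have h1 := hk.2 T hT.1
        have h2 := hl.2 T hT.1
        have h3 := hT.2
        refine ⟨hT.1, ?_⟩
        rw [pair_arc] at h1 h2 h3 ⊢
        omega
      · rw [mem_activeMembers, pair_arc, hSk]
        refine ⟨hS, ?_⟩
        rcases hu with rfl | rfl <;> simpa using hSl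
      · rw [mem_activeMembers, pair_arc, hSk]
        simp
    refine TransGen.loops i j (ih _ ?_ _ hb rfl) (ih _ ?_ _ hb' rfl) hij hli hlj ha.1 h2
    · rw [Prod.Lex.toLex_lt_toLex]
      exact Or.inl (hlt i j s t hs ht hij hae hb hb')
    · rw [Prod.Lex.toLex_lt_toLex]
      exact Or.inl (hlt j i t s ht hs hij.symm (by rw [hae, add_comm]) hb' hb)
  exact TransGen.base ⟨ha, htr, hlm⟩

/-- A minimal graph that generates the polar arcs of a separating family consists of the
irreducible ones. -/
lemma IsHasseDiagram.arcs_eq {F : Set (SignedSet n)}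
    (hsep : ∀ d : Fin n → ℝ, (∀ S ∈ F, S.eval d = 0) → d = 0) {H G : BidirectedGraph n}
    (hG : G.transClosure.1 = polarArcs F) (hH : IsHasseDiagram H G) :
    H.1 = irreducibleArcs (polarArcs F) := by
  have hT : ∀ a, TransGen H.1 a ↔ a ∈ polarArcs F := fun a => by
    rw [← hG, ← hH.prop]; rfl
  -- A derivation of an irreducible arc cannot end with a rule, so the arc belongs to every
  -- generating graph.
  have hsub : irreducibleArcs (polarArcs F) ⊆ H.1 := by
    rintro a ⟨ha, htr, hlm⟩
    have := (hT a).2 ha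
    cases this with
    | base h => exact h
    | trans v hb hb' hl hv _ =>
      exact absurd ⟨_, (hT _).1 hb, _, (hT _).1 hb', v, hl, hv, rfl⟩ htr
    | loops i j hb hb' hij hi hj _ h2 =>
      exact absurd ⟨_, (hT _).1 hb, _, (hT _).1 hb', i, j, hij, hi, hj, h2⟩ hlm
  let E : BidirectedGraph n := ⟨irreducibleArcs (polarArcs F), fun a ha => ha.1.1⟩
  have hE : E.transClosure = G.transClosure := by
    refine Subtype.ext (Set.ext fun a => ?_)
    rw [hG]
    exact ⟨fun h => TransGen.mem_polarArcs (fun b hb => hb.1) h, transGen_irreducibleArcs hsep a⟩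
  exact Set.Subset.antisymm (hH.le_of_le hE hsub) hsub

end Arcs

/-! ### Tight sets, feasible directions and vertices -/

section Polyhedron

variable {n : ℕ}

open SignedSet Filter Topology

/-- By modularity of `eval` the slacks at `S ⊔ T` and `S ⊓ T` add up to at most zero when `S` and
`T` are tight, and both are nonnegative. -/
lemma isClosedFamily_tightFamily {f : SignedSet n → ℝ} (hf : IsBisubmodular f)
    (hf0 : f (SignedSet.empty n) = 0) {x : Fin n → ℝ} (hx : x ∈ bisubPolyhedron f) :
    IsClosedFamily (tightFamily f x) := by
  have key : ∀ S ∈ tightFamily f x, ∀ T ∈ tightFamily f x,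
      S.reducedUnion T ∈ tightFamily f x ∧ S.inter T ∈ tightFamily f x := by
    intro S hS T hT
    have h₁ := hf S T
    have h₂ := eval_modular x S T
    have h₃ := hx (S.reducedUnion T)
    have h₄ := hx (S.inter T)
    simp only [tightFamily, Set.mem_ofPred_eq] at hS hT ⊢
    constructor <;> linarith
  exact ⟨by simp [tightFamily, hf0, eval_eq_sum, sgn_empty], fun S hS T hT => (key S hS T hT).1,
    fun S hS T hT => (key S hS T hT).2⟩

/-- There are finitely many constraints: the slack ones survive a small step by continuity, the
tight ones by `hd`. -/
lemma exists_add_smul_mem {f : SignedSet n → ℝ} {x d : Fin n → ℝ} (hx : x ∈ bisubPolyhedron f)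
    (hd : ∀ S ∈ tightFamily f x, S.eval d ≤ 0) : ∃ α : ℝ, 0 < α ∧ x + α • d ∈ bisubPolyhedron f := by
  have h : ∀ᶠ α in 𝓝[>] (0 : ℝ), ∀ S : SignedSet n, S.eval (x + α • d) ≤ f S := by
    rw [eventually_all]
    intro S
    simp only [eval_add, eval_smul]
    by_cases hS : S ∈ tightFamily f x
    · filter_upwards [self_mem_nhdsWithin] with α hα
      have h₁ := hx S
      have h₂ := mul_nonpos_of_nonneg_of_nonpos (le_of_lt hα) (hd S hS)
      linarith
    · have hlt : S.eval x + 0 * S.eval d < f S := by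
        rw [zero_mul, add_zero]
        exact lt_of_le_of_ne (hx S) hS
      have hc : Continuous fun α : ℝ => S.eval x + α * S.eval d := by fun_prop
      exact nhdsWithin_le_nhds ((hc.tendsto 0).eventually (gt_mem_nhds hlt) |>.mono
        fun _ h => le_of_lt h)
  obtain ⟨α, hα, hα0⟩ := (h.and self_mem_nhdsWithin).exists
  exact ⟨α, hα0, hα⟩

lemma eval_nonpos_of_mem {f : SignedSet n → ℝ} {x d : Fin n → ℝ} {α : ℝ} (hα : 0 < α)
    (h : x + α • d ∈ bisubPolyhedron f) {S : SignedSet n} (hS : S ∈ tightFamily f x) :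
    S.eval d ≤ 0 := by
  have h₁ := h S
  rw [eval_add, eval_smul, show S.eval x = f S from hS] at h₁
  by_contra! hcon
  have := mul_pos hα hcon
  linarith

lemma notMem_satPlus_iff {f : SignedSet n → ℝ} {x : Fin n → ℝ} (hx : x ∈ bisubPolyhedron f)
    {i : Fin n} : i ∉ satPlus f x ↔ ¬ ∃ S ∈ tightFamily f x, S.sgn i = 1 := by
  simp only [satPlus, Set.mem_ofPred_eq, not_forall, not_not, exists_prop]
  constructor
  · rintro ⟨α, hα, h⟩ ⟨S, hS, hSi⟩
    have := eval_nonpos_of_mem hα h hS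
    rw [eval_single, hSi] at this
    norm_num at this
  · intro h
    refine exists_add_smul_mem hx fun S hS => ?_
    rw [eval_single]
    have : S.sgn i ≠ 1 := fun e => h ⟨S, hS, e⟩
    rcases S.sgn_cases i with h | h | h <;> simp_all

lemma notMem_satMinus_iff {f : SignedSet n → ℝ} {x : Fin n → ℝ} (hx : x ∈ bisubPolyhedron f)
    {i : Fin n} : i ∉ satMinus f x ↔ ¬ ∃ S ∈ tightFamily f x, S.sgn i = -1 := by
  simp only [satMinus, Set.mem_ofPred_eq, not_forall, not_not, exists_prop]
  have hneg : ∀ α : ℝ, x - α • Pi.single i (1 : ℝ) = x + α • Pi.single i (-1 : ℝ) := fun α => by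
    rw [Pi.single_neg, smul_neg, sub_eq_add_neg]
  simp only [hneg]
  constructor
  · rintro ⟨α, hα, h⟩ ⟨S, hS, hSi⟩
    have := eval_nonpos_of_mem hα h hS
    rw [eval_single, hSi] at this
    norm_num at this
  · intro h
    refine exists_add_smul_mem hx fun S hS => ?_
    rw [eval_single]
    have : S.sgn i ≠ -1 := fun e => h ⟨S, hS, e⟩
    rcases S.sgn_cases i with h | h | h <;> simp_all

lemma neg_unitVec (i : Fin n) : -unitVec i = Pi.single i (-1) := by
  rw [unitVec, Pi.single_neg]

lemma mem_satPlus_iff {f : SignedSet n → ℝ} {x : Fin n → ℝ} (hx : x ∈ bisubPolyhedron f)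
    {i : Fin n} : i ∈ satPlus f x ↔ ∃ S ∈ tightFamily f x, S.sgn i = 1 := by
  rw [← not_iff_not]; exact notMem_satPlus_iff hx

lemma mem_satMinus_iff {f : SignedSet n → ℝ} {x : Fin n → ℝ} (hx : x ∈ bisubPolyhedron f)
    {i : Fin n} : i ∈ satMinus f x ↔ ∃ S ∈ tightFamily f x, S.sgn i = -1 := by
  rw [← not_iff_not]; exact notMem_satMinus_iff hx

/-- The arcs given by the signed dependence function. -/
lemma vertexArc_of_dep {f : SignedSet n → ℝ} {x : Fin n → ℝ} (hx : x ∈ bisubPolyhedron f)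
    {i j : Fin n} (hij : i ≠ j) {s t : ℤ} (hs : s = 1 ∨ s = -1) (ht : t = 1 ∨ t = -1)
    (hex : ∃ S ∈ tightFamily f x, S.sgn i = s)
    (h : ∀ S ∈ tightFamily f x, S.sgn i = s → S.sgn j = -t) :
    VertexArc f x (Pi.single i s + Pi.single j t) := by
  rcases hs with rfl | rfl <;> rcases ht with rfl | rfl
  · refine VertexArc.add i j hij (Or.inl ⟨(mem_satPlus_iff hx).2 hex, fun S hS hSi => ?_⟩)
    exact mem_neg_iff.2 (h S hS (mem_pos_iff.1 hSi))
  · rw [← neg_unitVec, ← sub_eq_add_neg]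
    refine VertexArc.sub i j hij (Or.inl ⟨(mem_satPlus_iff hx).2 hex, fun S hS hSi => ?_⟩)
    exact mem_pos_iff.2 (by simpa using h S hS (mem_pos_iff.1 hSi))
  · rw [← neg_unitVec, add_comm, ← sub_eq_add_neg]
    refine VertexArc.sub j i hij.symm (Or.inr ⟨(mem_satMinus_iff hx).2 hex, fun S hS hSi => ?_⟩)
    exact mem_neg_iff.2 (by simpa using h S hS (mem_neg_iff.1 hSi))
  · rw [← neg_unitVec, ← neg_unitVec, ← sub_eq_add_neg]
    refine VertexArc.neg i j hij (Or.inl ⟨(mem_satMinus_iff hx).2 hex, fun S hS hSi => ?_⟩)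
    exact mem_pos_iff.2 (by simpa using h S hS (mem_neg_iff.1 hSi))

lemma VertexArc.mem_polarArcs {f : SignedSet n → ℝ} {x : Fin n → ℝ} (hx : x ∈ bisubPolyhedron f)
    (hF : IsClosedFamily (tightFamily f x)) {a : Fin n → ℤ} (h : VertexArc f x a) :
    a ∈ polarArcs (tightFamily f x) := by
  have key : ∀ {i j : Fin n} {s t : ℤ}, i ≠ j → (s = 1 ∨ s = -1) → (t = 1 ∨ t = -1) →
      (∃ S ∈ tightFamily f x, S.sgn i = s) →
      (∀ S ∈ tightFamily f x, S.sgn i = s → S.sgn j = -t) →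
      (Pi.single i s + Pi.single j t : Fin n → ℤ) ∈ polarArcs (tightFamily f x) :=
    fun hij hs ht hex h => _root_.mem_polarArcs hs ht (fun e => absurd e hij)
      (hF.nonpos_of_imp hs ht hex h)
  cases h with
  | loopPos i h => exact loop_mem_polarArcs (by simp) ((notMem_satPlus_iff hx).1 h)
  | loopNeg i h =>
    rw [sub_eq_add_neg, neg_unitVec]
    exact loop_mem_polarArcs (by simp) ((notMem_satMinus_iff hx).1 h)
  | sub i j hij h =>
    rw [sub_eq_add_neg, neg_unitVec]
    rcases h with ⟨h₁, h₂⟩ | ⟨h₁, h₂⟩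
    · exact key hij (by simp) (by simp) ((mem_satPlus_iff hx).1 h₁) fun S hS hSi =>
        mem_pos_iff.1 (h₂ S hS (mem_pos_iff.2 hSi))
    · rw [add_comm]
      exact key hij.symm (by simp) (by simp) ((mem_satMinus_iff hx).1 h₁) fun S hS hSi =>
        mem_neg_iff.1 (h₂ S hS (mem_neg_iff.2 hSi))
  | add i j hij h =>
    rcases h with ⟨h₁, h₂⟩ | ⟨h₁, h₂⟩
    · exact key hij (by simp) (by simp) ((mem_satPlus_iff hx).1 h₁) fun S hS hSi =>
        mem_neg_iff.1 (h₂ S hS (mem_pos_iff.2 hSi))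
    · rw [add_comm]
      exact key hij.symm (by simp) (by simp) ((mem_satPlus_iff hx).1 h₁) fun S hS hSi =>
        mem_neg_iff.1 (h₂ S hS (mem_pos_iff.2 hSi))
  | neg i j hij h =>
    rw [sub_eq_add_neg, neg_unitVec, neg_unitVec]
    rcases h with ⟨h₁, h₂⟩ | ⟨h₁, h₂⟩
    · exact key hij (by simp) (by simp) ((mem_satMinus_iff hx).1 h₁) fun S hS hSi =>
        mem_pos_iff.1 (h₂ S hS (mem_neg_iff.2 hSi))
    · rw [add_comm]
      exact key hij.symm (by simp) (by simp) ((mem_satMinus_iff hx).1 h₁) fun S hS hSi =>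
        mem_pos_iff.1 (h₂ S hS (mem_neg_iff.2 hSi))

/-- The transitive closure of `G(x)` consists of the arcs that are feasible directions at `x`. -/
lemma transClosure_vertexGraph {f : SignedSet n → ℝ} {x : Fin n → ℝ}
    (hx : x ∈ bisubPolyhedron f) (hF : IsClosedFamily (tightFamily f x)) :
    (vertexGraph f x).transClosure.1 = polarArcs (tightFamily f x) := by
  refine Set.Subset.antisymm
    (fun a ha => TransGen.mem_polarArcs (fun b hb => VertexArc.mem_polarArcs hx hF hb) ha) ?_
  rintro a ⟨harc, hneg⟩
  have hloop : ∀ (k : Fin n) (r : ℤ), (r = 1 ∨ r = -1) →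
      (¬ ∃ S ∈ tightFamily f x, S.sgn k = r) → VertexArc f x (Pi.single k r + Pi.single k r) := by
    rintro k r (rfl | rfl) h
    · exact VertexArc.loopPos k ((notMem_satPlus_iff hx).2 h)
    · rw [← neg_unitVec, ← sub_eq_add_neg]
      exact VertexArc.loopNeg k ((notMem_satMinus_iff hx).2 h)
  have hdep : ∀ (i j : Fin n) (s t : ℤ), (s = 1 ∨ s = -1) → (t = 1 ∨ t = -1) →
      a = Pi.single i s + Pi.single j t → ∀ S ∈ tightFamily f x, S.sgn i = s → S.sgn j = -t := by
    rintro i j s t hs ht rfl S hS hSi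
    have := hneg S hS
    rw [pair_arc, hSi] at this
    rcases hs with rfl | rfl <;> rcases ht with rfl | rfl <;>
      rcases S.sgn_cases j with h | h | h <;> simp [h] at this ⊢
  obtain ⟨i, j, s, t, hs, ht, hst, hae⟩ := isArcBoundary_iff.1 harc
  by_cases hij : i = j
  · subst hij
    obtain rfl := hst rfl
    rw [hae]
    refine TransGen.base (hloop i s hs ?_)
    rintro ⟨S, hS, hSi⟩
    have := hdep i i s s hs hs hae S hS hSi
    rw [hSi] at this
    rcases hs with rfl | rfl <;> norm_num at this
  by_cases hi : ∃ S ∈ tightFamily f x, S.sgn i = s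
  · rw [hae]
    exact TransGen.base (vertexArc_of_dep hx hij hs ht hi (hdep i j s t hs ht hae))
  have hae' : a = Pi.single j t + Pi.single i s := by rw [hae, add_comm]
  by_cases hj : ∃ S ∈ tightFamily f x, S.sgn j = t
  · rw [hae']
    exact TransGen.base (vertexArc_of_dep hx (Ne.symm hij) ht hs hj (hdep j i t s ht hs hae'))
  -- With both ends unsaturated no dependence set is defined, so `G(x)` need not contain the arc; it
  -- is the mean of two selfloops.
  refine TransGen.loops i j (TransGen.base (hloop i s hs hi)) (TransGen.base (hloop j t ht hj)) hij
    (isSelfloopAt_single hs) (isSelfloopAt_single ht) harc ?_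
  rw [hae, two_smul]; abel

/-- The tight sets at a vertex separate directions. -/
lemma eq_zero_of_eval_tight {f : SignedSet n → ℝ} {x : Fin n → ℝ}
    (hx : x ∈ (bisubPolyhedron f).extremePoints ℝ) (d : Fin n → ℝ)
    (hd : ∀ S ∈ tightFamily f x, S.eval d = 0) : d = 0 := by
  obtain ⟨α, hα, h₁⟩ := exists_add_smul_mem hx.1 fun S hS => (hd S hS).le
  obtain ⟨β, hβ, h₂⟩ := exists_add_smul_mem (d := -d) hx.1 fun S hS => by
    rw [← neg_one_smul ℝ d, eval_smul, hd S hS, mul_zero]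
  -- Both `d` and `-d` are feasible; the weights make `α • d` and `β • -d` cancel.
  have hmem : x ∈ openSegment ℝ (x + α • d) (x + β • -d) := by
    refine ⟨β / (α + β), α / (α + β), by positivity, by positivity, ?_, ?_⟩
    · field_simp; ring
    · funext k
      simp only [Pi.add_apply, Pi.smul_apply, Pi.neg_apply, smul_eq_mul]
      field_simp
      ring
  have := (mem_extremePoints.1 hx).2 _ h₁ _ h₂ hmem
  simpa [hα.ne'] using this.1

/-- A constraint that is tight at a point of an open segment is tight at its endpoints. -/
lemma eval_eq_of_mem_openSegment {f : SignedSet n → ℝ} {u v y : Fin n → ℝ}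
    (hu : u ∈ bisubPolyhedron f) (hv : v ∈ bisubPolyhedron f) (h : y ∈ openSegment ℝ u v)
    {S : SignedSet n} (hS : S ∈ tightFamily f y) : S.eval u = f S := by
  obtain ⟨α, β, hα, hβ, hαβ, rfl⟩ := h
  have h₁ := hu S
  have h₂ := hv S
  have h₃ : S.eval (α • u + β • v) = f S := hS
  rw [eval_add, eval_smul, eval_smul] at h₃
  refine le_antisymm h₁ ?_
  by_contra! hcon
  have h₄ := mul_lt_mul_of_pos_left hcon hα
  have h₅ := mul_le_mul_of_nonneg_left h₂ hβ.le
  have h₆ : α * f S + β * f S = f S := by rw [← add_mul, hαβ, one_mul]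
  linarith

/-- A point of the polyhedron whose tight sets separate directions is a vertex. -/
lemma mem_extremePoints_of_separating {f : SignedSet n → ℝ} {y : Fin n → ℝ}
    (hy : y ∈ bisubPolyhedron f)
    (hsep : ∀ d : Fin n → ℝ, (∀ S ∈ tightFamily f y, S.eval d = 0) → d = 0) :
    y ∈ (bisubPolyhedron f).extremePoints ℝ := by
  rw [mem_extremePoints]
  refine ⟨hy, ?_⟩
  have key : ∀ u ∈ bisubPolyhedron f, ∀ v ∈ bisubPolyhedron f, y ∈ openSegment ℝ u v → u = y := by
    intro u hu v hv h
    rw [← sub_eq_zero]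
    refine hsep _ fun S hS => ?_
    rw [eval_sub, eval_eq_of_mem_openSegment hu hv h hS, show S.eval y = f S from hS, sub_self]
  exact fun u hu v hv h => ⟨key u hu v hv h, key v hv u hu (by rwa [openSegment_symm])⟩

end Polyhedron

/-! ### The greedy vertex and heights of arcs -/

section Greedy

variable {n : ℕ}

open SignedSet

lemma eval_ofPos (x : Fin n → ℝ) (X : Finset (Fin n)) : (ofPos X).eval x = ∑ k ∈ X, x k := by
  simp [SignedSet.eval, ofPos]

/-- A value on `{i + 1, …, n}` is a value on an upper set `{j, …, n}` or on the empty set. -/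
lemma Ioi_eq_Ici_or_empty (i : Fin n) :
    (∃ j, i < j ∧ Finset.Ioi i = Finset.Ici j) ∨ Finset.Ioi i = ∅ := by
  by_cases h : (i : ℕ) + 1 < n
  · refine Or.inl ⟨⟨i + 1, h⟩, Fin.lt_def.2 (Nat.lt_succ_self _), ?_⟩
    ext k
    simp only [Finset.mem_Ioi, Finset.mem_Ici, Fin.lt_def, Fin.le_def]
    omega
  · refine Or.inr (Finset.eq_empty_of_forall_notMem fun k hk => ?_)
    rw [Finset.mem_Ioi, Fin.lt_def] at hk
    omega

lemma ofPos_empty : ofPos (∅ : Finset (Fin n)) = SignedSet.empty n := rfl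

/-- The greedy vector is tight on all upper sets. -/
lemma eval_greedyVertex {f : SignedSet n → ℝ} (hf0 : f (SignedSet.empty n) = 0) (i : Fin n) :
    (ofPos (Finset.Ici i)).eval (greedyVertex f) = f (ofPos (Finset.Ici i)) := by
  induction h : n - (i : ℕ) using Nat.strong_induction_on generalizing i with
  | _ m ih =>
  have h₁ : ∑ k ∈ Finset.Ioi i, greedyVertex f k = f (ofPos (Finset.Ioi i)) := by
    rcases Ioi_eq_Ici_or_empty i with ⟨j, hij, hj⟩ | h0
    · rw [hj, ← eval_ofPos]
      refine ih _ ?_ j rfl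
      have := j.2
      rw [Fin.lt_def] at hij
      omega
    · rw [h0, ofPos_empty, hf0, Finset.sum_empty]
  rw [eval_ofPos, ← Finset.Ioi_insert, Finset.sum_insert (by simp), h₁, greedyVertex,
    Finset.Ioi_insert]
  ring

/-- The greedy vector is the only one that is tight on all upper sets. -/
lemma eq_greedyVertex {f : SignedSet n → ℝ} (hf0 : f (SignedSet.empty n) = 0) {x : Fin n → ℝ}
    (h : ∀ i, ofPos (Finset.Ici i) ∈ tightFamily f x) : x = greedyVertex f := by
  funext i
  have h₁ : ∑ k ∈ Finset.Ioi i, x k = f (ofPos (Finset.Ioi i)) := by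
    rcases Ioi_eq_Ici_or_empty i with ⟨j, -, hj⟩ | h0
    · rw [hj, ← eval_ofPos]
      exact h j
    · rw [h0, ofPos_empty, hf0, Finset.sum_empty]
  have h₂ : (ofPos (Finset.Ici i)).eval x = f (ofPos (Finset.Ici i)) := h i
  rw [eval_ofPos, ← Finset.Ioi_insert, Finset.sum_insert (by simp), Finset.Ioi_insert] at h₂
  rw [greedyVertex]
  linarith

/-- The value of an arc on the weights `1, …, n`. -/
def arcHeight (a : Fin n → ℤ) : ℤ := ∑ k, a k * ((k : ℤ) + 1)

lemma arcHeight_arc (i j : Fin n) (s t : ℤ) :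
    arcHeight (Pi.single i s + Pi.single j t) = s * ((i : ℤ) + 1) + t * ((j : ℤ) + 1) := by
  simp [arcHeight, add_mul, Finset.sum_add_distrib, Pi.single_apply]

/-- Height is additive, so negativity passes to sums and to means of selfloops. -/
lemma TransGen.arcHeight_neg {A : Set (Fin n → ℤ)} (hA : ∀ a ∈ A, arcHeight a < 0)
    {a : Fin n → ℤ} (h : TransGen A a) : arcHeight a < 0 := by
  have hadd : ∀ a b : Fin n → ℤ, arcHeight (a + b) = arcHeight a + arcHeight b := fun a b => by
    simp [arcHeight, add_mul, Finset.sum_add_distrib]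
  induction h with
  | base h => exact hA _ h
  | trans _ _ _ _ _ _ ih ih' => rw [hadd]; exact add_neg ih ih'
  | loops i j _ _ _ _ _ _ h2 ih ih' =>
    have := congrArg arcHeight h2
    rw [two_smul, hadd, hadd] at this
    linarith

lemma unitVec_sub (i j : Fin n) :
    unitVec i - unitVec j = Pi.single i 1 + Pi.single j (-1) := by
  rw [sub_eq_add_neg, neg_unitVec]; rfl

/-- A graph without arcs `i + j` and `j - i`, `i < j`, has arcs of negative height only. -/
lemma arcHeight_neg_of_forall (H : BidirectedGraph n)
    (h₁ : ¬ ∃ i j : Fin n, i ≤ j ∧ unitVec i + unitVec j ∈ H.1)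
    (h₂ : ¬ ∃ i j : Fin n, i < j ∧ unitVec j - unitVec i ∈ H.1) :
    ∀ a ∈ H.1, arcHeight a < 0 := by
  intro a ha
  have hsub : ∀ i j : Fin n, i ≠ j →
      Pi.single i 1 + Pi.single j (-1) ∈ H.1 → (i : ℤ) < j := by
    intro i j hij h
    rw [← unitVec_sub] at h
    rcases lt_or_gt_of_ne hij with h' | h'
    · exact_mod_cast h'
    · exact absurd ⟨j, i, h', h⟩ h₂
  obtain ⟨i, j, s, t, hs, ht, hij, rfl⟩ := isArcBoundary_iff.1 (H.2 a ha)
  rw [arcHeight_arc]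
  rcases hs with rfl | rfl <;> rcases ht with rfl | rfl
  · rcases le_total i j with h | h
    · exact absurd ⟨i, j, h, ha⟩ h₁
    · exact absurd ⟨j, i, h, by rw [add_comm]; exact ha⟩ h₁
  · have := hsub i j (fun e => by simpa using hij e) ha
    omega
  · have := hsub j i (fun e => by simpa using hij e.symm) (by rwa [add_comm])
    omega
  · omega

/-- A point at which all feasible arcs have negative height is the greedy vertex. -/
lemma eq_greedyVertex_of_arcHeight_neg {f : SignedSet n → ℝ} (hf0 : f (SignedSet.empty n) = 0)
    {x : Fin n → ℝ} (hF : IsClosedFamily (tightFamily f x))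
    (h : ∀ a ∈ polarArcs (tightFamily f x), arcHeight a < 0) : x = greedyVertex f := by
  refine eq_greedyVertex hf0 fun i => hF.mem_of_cover _ fun k hk => ?_
  have hik : i ≤ k := by
    rw [sgn_ofPos] at hk
    by_contra hcon
    simp [hcon] at hk
  -- Otherwise the selfloop `2k` is feasible and has positive height.
  have hex : ∃ S ∈ tightFamily f x, S.sgn k = 1 := by
    by_contra hcon
    have := h _ (loop_mem_polarArcs (by simp) hcon)
    rw [arcHeight_arc] at this
    omega
  obtain ⟨D, hD, hDk, hmin⟩ := hF.exists_least hex
  have hone : ∀ l, i ≤ l → (ofPos (Finset.Ici i)).sgn l = 1 := fun l hl => by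
    simp [sgn_ofPos, hl]
  refine ⟨D, hD, fun l hl => ?_, by rw [hDk, hone k hik]⟩
  -- A further element `l` of `D` makes `k + l` feasible if its sign is negative, and `k - l` if it
  -- is positive. Negative height excludes the former and forces `k < l` in the latter, so `D` lies
  -- inside `({i, …, n}, ∅)`.
  by_cases hkl : k = l
  · rw [← hkl, hDk, hone k hik]
  rcases D.sgn_cases l with hDl | hDl | hDl
  · have := h _ (mem_polarArcs (i := k) (j := l) (s := 1) (t := 1) (by simp) (by simp)
      (fun _ => rfl) (hF.nonpos_of_imp (by simp) (by simp) hex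
        fun S hS hSk => by rw [hmin S hS hSk l hl, hDl]))
    rw [arcHeight_arc] at this
    omega
  · exact absurd hDl hl
  · have := h _ (mem_polarArcs (i := k) (j := l) (s := 1) (t := -1) (by simp) (by simp)
      (fun e => absurd e hkl) (hF.nonpos_of_imp (by simp) (by simp) hex
        fun S hS hSk => by rw [hmin S hS hSk l hl, hDl, neg_neg]))
    rw [arcHeight_arc] at this
    rw [hDl, hone l]
    rw [Fin.le_def] at hik ⊢
    omega

/-- No feasible arc at the greedy vertex is of type `i + j`, or `j - i` with `i < j`. -/
lemma not_mem_polarArcs_greedyVertex {f : SignedSet n → ℝ} (hf0 : f (SignedSet.empty n) = 0) :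
    (¬ ∃ i j : Fin n, i ≤ j ∧ unitVec i + unitVec j ∈ polarArcs (tightFamily f (greedyVertex f))) ∧
    ¬ ∃ i j : Fin n, i < j ∧ unitVec j - unitVec i ∈ polarArcs (tightFamily f (greedyVertex f)) := by
  constructor
  · rintro ⟨i, j, -, h⟩
    -- On the tight set `({j, …, n}, ∅)` the end `j` contributes `1` and the end `i` at least `0`.
    have := h.2 _ (eval_greedyVertex hf0 j)
    rw [unitVec, unitVec, pair_arc, sgn_ofPos, sgn_ofPos] at this
    split_ifs at this <;> simp_all
  · rintro ⟨i, j, hij, h⟩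
    have := h.2 _ (eval_greedyVertex hf0 j)
    rw [unitVec_sub, pair_arc, sgn_ofPos, sgn_ofPos] at this
    simp [hij.not_ge] at this

end Greedy

/-! ### Maximal steps along irreducible arcs -/

section Adjacency

variable {n : ℕ}

open SignedSet

/-- The capacity exists and is positive in a feasible direction that increases a coordinate. -/
lemma exists_isCapacity {f : SignedSet n → ℝ} {x : Fin n → ℝ} (hx : x ∈ bisubPolyhedron f)
    {a : Fin n → ℤ} (ha : ∀ S ∈ tightFamily f x, S.pair a ≤ 0) {j : Fin n} (haj : 0 < a j) :
    ∃ c, IsCapacity f x a c ∧ 0 < c := by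
  obtain ⟨α, hα, hmem⟩ := exists_add_smul_mem (d := fun k => (a k : ℝ)) hx fun S hS => by
    rw [eval_intCast]; exact_mod_cast ha S hS
  set A : Set ℝ := {α : ℝ | 0 ≤ α ∧ x + α • (fun k => (a k : ℝ)) ∈ bisubPolyhedron f} with hA
  have hAα : α ∈ A := ⟨hα.le, hmem⟩
  have hclosed : IsClosed A := by
    have : A = Set.Ici 0 ∩ ⋂ S : SignedSet n,
        {α : ℝ | S.eval x + α * S.eval (fun k => (a k : ℝ)) ≤ f S} := by
      ext β
      simp [hA, bisubPolyhedron, eval_add, eval_smul]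
    rw [this]
    exact isClosed_Ici.inter (isClosed_iInter fun S => isClosed_le (by fun_prop) continuous_const)
  have hbdd : BddAbove A := by
    -- The constraint of `({j}, ∅)` bounds the step, as the integer `a j` is at least `1`.
    refine ⟨f (ofPos {j}) - x j, fun β hβ => ?_⟩
    have h₁ := hβ.2 (ofPos {j})
    rw [eval_ofPos, Finset.sum_singleton, Pi.add_apply, Pi.smul_apply, smul_eq_mul] at h₁
    have h₂ : (1 : ℝ) ≤ a j := by exact_mod_cast haj
    have h₃ := mul_le_mul_of_nonneg_left h₂ hβ.1
    linarith
  refine ⟨sSup A, ⟨hclosed.csSup_mem ⟨α, hAα⟩ hbdd, fun β hβ => le_csSup hbdd hβ⟩, ?_⟩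
  exact hα.trans_le (le_csSup hbdd hAα)

/-- Moving from a vertex along an irreducible arc as far as possible leads to an adjacent vertex. -/
lemma adjacentVertices_of_mem_irreducibleArcs {f : SignedSet n → ℝ} {x : Fin n → ℝ}
    (hx : x ∈ (bisubPolyhedron f).extremePoints ℝ) (hF : IsClosedFamily (tightFamily f x))
    {a : Fin n → ℤ} (ha : a ∈ irreducibleArcs (polarArcs (tightFamily f x))) {c : ℝ}
    (hc : IsCapacity f x a c) (hc0 : 0 < c) :
    AdjacentVertices (bisubPolyhedron f) x (x + c • fun k => (a k : ℝ)) := by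
  have hsep := eq_zero_of_eval_tight hx
  have hface := exists_eq_smul_of_mem_irreducibleArcs hF hsep ha
  set v : Fin n → ℝ := fun k => (a k : ℝ) with hv
  have hvS : ∀ S : SignedSet n, S.eval v = (S.pair a : ℝ) := fun S => eval_intCast a S
  obtain ⟨S₀, hS₀, hS₀a⟩ := exists_pair_neg hsep ha.1
  have hv0 : v ≠ 0 := by
    intro h
    have := hvS S₀
    rw [h] at this
    have h0 : S₀.eval (0 : Fin n → ℝ) = 0 := by simp [eval_eq_sum]
    rw [h0] at this
    have : S₀.pair a = 0 := by exact_mod_cast this.symm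
    omega
  have hy : x + c • v ∈ bisubPolyhedron f := hc.1.2
  have htight : ∀ S ∈ tightFamily f x, S.pair a = 0 → ∀ β : ℝ, S ∈ tightFamily f (x + β • v) := by
    intro S hS hSa β
    show S.eval _ = f S
    rw [eval_add, eval_smul, hvS, hSa, show S.eval x = f S from hS]
    simp
  refine ⟨hx, mem_extremePoints_of_separating hy fun d hd => ?_, ?_, ?_⟩
  · obtain ⟨β, rfl⟩ := hface d fun S hS hSa => hd S (htight S hS hSa c)
    by_contra hne
    have hβ : β ≠ 0 := by rintro rfl; simp at hne
    -- If a nonzero multiple of `v` vanished on all sets tight at the new point, a further step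
    -- along `v` would be feasible, against the maximality of `c`.
    obtain ⟨α, hα, h⟩ := exists_add_smul_mem (d := v) hy fun S hS => by
      have := hd S hS
      rw [eval_smul] at this
      exact ((mul_eq_zero.1 this).resolve_left hβ).le
    rw [add_assoc, ← add_smul] at h
    have := hc.2 ⟨by positivity, h⟩
    linarith
  · intro h
    have : c • v = 0 := by simpa using h.symm
    exact (smul_ne_zero hc0.ne' hv0) this
  · refine ⟨?_, ?_⟩
    · rintro _ ⟨α, β, hα, hβ, hαβ, rfl⟩ S
      have h₁ := mul_le_mul_of_nonneg_left (hx.1 S) hα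
      have h₂ := mul_le_mul_of_nonneg_left (hy S) hβ
      have h₃ : α * f S + β * f S = f S := by rw [← add_mul, hαβ, one_mul]
      rw [eval_add, eval_smul, eval_smul]
      linarith
    · intro u hu w hw z hz hzuw
      rw [segment_eq_image'] at hz
      obtain ⟨θ, -, rfl⟩ := hz
      rw [add_sub_cancel_left] at hzuw
      dsimp only at hzuw
      rw [smul_smul] at hzuw
      -- Sets tight at `x` on which `a` vanishes are tight along the whole line, hence at `u`; so
      -- `u` lies on the line. The set `S₀` gives `0 ≤ β`, the capacity gives `β ≤ c`.
      obtain ⟨β, hβ⟩ := hface (u - x) fun S hS hSa => by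
        rw [eval_sub, eval_eq_of_mem_openSegment hu hw hzuw (htight S hS hSa _),
          show S.eval x = f S from hS, sub_self]
      obtain rfl : u = x + β • v := by rw [← hβ]; abel
      have hβ0 : 0 ≤ β := by
        have h₁ := hu S₀
        rw [eval_add, eval_smul, hvS, show S₀.eval x = f S₀ from hS₀] at h₁
        have h₂ : (S₀.pair a : ℝ) < 0 := by exact_mod_cast hS₀a
        by_contra! hcon
        have := mul_pos_of_neg_of_neg hcon h₂
        linarith
      have hβc : β ≤ c := hc.2 ⟨hβ0, hu⟩
      rw [segment_eq_image']
      refine ⟨β / c, ⟨by positivity, (div_le_one hc0).2 hβc⟩, ?_⟩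
      dsimp only
      rw [add_sub_cancel_left, smul_smul, div_mul_cancel₀ _ hc0.ne']

end Adjacency

/-! ### Selection of the local search arc -/

section LocalSearch

variable {n : ℕ}

lemma Set.Nonempty.exists_isGreatest_fin {s : Set (Fin n)} (h : s.Nonempty) :
    ∃ i, IsGreatest s i := by
  obtain ⟨i, hi, hmax⟩ := Set.exists_max_image s id (Set.toFinite s) h
  exact ⟨i, hi, hmax⟩

lemma IsLocalSearchArc.unique {H : BidirectedGraph n} {a b : Fin n → ℤ}
    (ha : IsLocalSearchArc H a) (hb : IsLocalSearchArc H b) : a = b := by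
  obtain ⟨j, i, hj, h⟩ := ha
  obtain ⟨j', i', hj', h'⟩ := hb
  obtain rfl := hj.unique hj'
  rcases h with ⟨hi, rfl⟩ | ⟨he, hi, rfl⟩ <;> rcases h' with ⟨hi', rfl⟩ | ⟨he', hi', rfl⟩
  · rw [hi.unique hi']
  · exact absurd hi.1 (by rw [he']; exact Set.notMem_empty i)
  · exact absurd hi'.1 (by rw [he]; exact Set.notMem_empty i')
  · rw [hi.unique hi']

/-- The positive coefficient, at `j^*`, is recorded because it makes the capacity finite. -/
lemma exists_isLocalSearchArc {H : BidirectedGraph n}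
    (h : ∃ k, (plusPartners H k).Nonempty ∨ (minusPartners H k).Nonempty) :
    ∃ a, IsLocalSearchArc H a ∧ a ∈ H.1 ∧ ∃ j, 0 < a j := by
  obtain ⟨j, hj⟩ := Set.Nonempty.exists_isGreatest_fin
    (s := {k | (plusPartners H k).Nonempty ∨ (minusPartners H k).Nonempty}) h
  rcases (plusPartners H j).eq_empty_or_nonempty with he | hne
  · obtain ⟨i, hi⟩ := (hj.1.resolve_left (by rw [he]; simp)).exists_isGreatest_fin
    refine ⟨_, ⟨j, i, hj, Or.inr ⟨he, hi, rfl⟩⟩, hi.1.2, j, ?_⟩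
    simp [unitVec, hi.1.1.ne']
  · obtain ⟨i, hi⟩ := hne.exists_isGreatest_fin
    refine ⟨_, ⟨j, i, hj, Or.inl ⟨hi, rfl⟩⟩, by rw [add_comm]; exact hi.1.2, j, ?_⟩
    simp only [unitVec, Pi.add_apply, Pi.single_apply]
    split_ifs <;> norm_num at *

end LocalSearch

theorem mainTheorem4 (n : ℕ) (f : SignedSet n → ℝ) (hf : IsBisubmodular f)
    (hf0 : f (SignedSet.empty n) = 0) (x : Fin n → ℝ)
    (hx : x ∈ (bisubPolyhedron f).extremePoints ℝ)
    (H : BidirectedGraph n) (hH : IsHasseDiagram H (vertexGraph f x)) :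
    (((¬ ∃ i j : Fin n, i ≤ j ∧ unitVec i + unitVec j ∈ H.1) ∧
      (¬ ∃ i j : Fin n, i < j ∧ unitVec j - unitVec i ∈ H.1)) ↔ x = greedyVertex f) ∧
    (x ≠ greedyVertex f →
      ∃ y : Fin n → ℝ, IsLocalSearchValue f H x y ∧
        (∀ z : Fin n → ℝ, IsLocalSearchValue f H x z → z = y) ∧
        AdjacentVertices (bisubPolyhedron f) x y) := by
  have hF := isClosedFamily_tightFamily hf hf0 hx.1
  have hT := transClosure_vertexGraph hx.1 hF
  have hirr := hH.arcs_eq (eq_zero_of_eval_tight hx) hT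
  have hiff : ((¬ ∃ i j : Fin n, i ≤ j ∧ unitVec i + unitVec j ∈ H.1) ∧
      (¬ ∃ i j : Fin n, i < j ∧ unitVec j - unitVec i ∈ H.1)) ↔ x = greedyVertex f := by
    constructor
    · rintro ⟨h₁, h₂⟩
      refine eq_greedyVertex_of_arcHeight_neg hf0 hF fun a ha => ?_
      -- Every feasible arc lies in the transitive closure of `H`, so negative height on `H`
      -- suffices.
      rw [← hT, ← hH.prop] at ha
      exact TransGen.arcHeight_neg (arcHeight_neg_of_forall H h₁ h₂) ha
    · rintro rfl
      obtain ⟨h₁, h₂⟩ := not_mem_polarArcs_greedyVertex hf0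
      rw [hirr]
      exact ⟨fun ⟨i, j, hij, h⟩ => h₁ ⟨i, j, hij, h.1⟩, fun ⟨i, j, hij, h⟩ => h₂ ⟨i, j, hij, h.1⟩⟩
  refine ⟨hiff, fun hne => ?_⟩
  have hex : ∃ k, (plusPartners H k).Nonempty ∨ (minusPartners H k).Nonempty := by
    by_contra! hcon
    refine hne (hiff.1 ⟨?_, ?_⟩)
    · rintro ⟨i, j, hij, h⟩
      exact Set.notMem_empty i ((hcon j).1 ▸ (⟨hij, h⟩ : i ∈ plusPartners H j))
    · rintro ⟨i, j, hij, h⟩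
      exact Set.notMem_empty i ((hcon j).2 ▸ (⟨hij, h⟩ : i ∈ minusPartners H j))
  obtain ⟨a, ha, haH, j, haj⟩ := exists_isLocalSearchArc hex
  rw [hirr] at haH
  obtain ⟨c, hc, hc0⟩ := exists_isCapacity hx.1 haH.1.2 haj
  refine ⟨_, ⟨a, c, ha, hc, rfl⟩, ?_, adjacentVertices_of_mem_irreducibleArcs hx hF haH hc hc0⟩
  rintro z ⟨b, c', hb, hc', rfl⟩
  obtain rfl := ha.unique hb
  rw [hc.unique hc']
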